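/- **Stochastic linear bandit.** Let $\theta^*\in\mathbb{R}^d$. In each round $t=1,2,\dots$ there is a (possibly infinite) arm set $\mathcal{A}_t$, which may vary with $t$, and each arm $a\in\mathcal{A}_t$ has a context $x_{t,a}\in\mathbb{R}^d$. The learner pulls an arm $A_t\in\mathcal{A}_t$, writes $X_t=x_{t,A_t}$, and receives the reward $Y_t=\langle\theta^*,X_t\rangle+\eta_t$, where the noise $\eta_t$ is conditionally $R$-sub-Gaussian: for every $s\in\mathbb{R}$, almost surely, $$\mathbb{E}\big[\exp(s\eta_t)\mid A_1,\dots,A_t,Y_1,\dots,Y_{t-1}\big]\le \exp(s^2R^2/2).$$ The gap of an arm $b\in\mathcal{A}_t$ is $\Delta_{t,b}=\max_{a\in\mathcal{A}_t}\langle\theta^*,x_{t,a}\rangle-\langle\theta^*,x_{t,b}\rangle$ (assumed finite), and the expected cumulative regret is $R_T=\mathbb{E}\big[\sum_{t=1}^T\Delta_{t,A_t}\big]$. Here and below $\max$ is read as the supremum if it is not attained. **LinIMED-1.** Fix $\lambda,S,L>0$ and $R\ge 0$. Put $V_0=\lambda I$, $W_0=0$, $V_t=V_{t-1}+X_tX_t^\top$,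 $W_t=W_{t-1}+Y_tX_t$, $\hat\theta_t=V_t^{-1}W_t$, $\|x\|_{V^{-1}}^2=x^\top V^{-1}x$, and $$\beta_{t-1}=\Big(R\sqrt{d\log\big((1+(t-1)L^2/\lambda)\,t^2\big)}+\sqrt{\lambda}\,S\Big)^2$$ (that is, the concentration parameter in round $t$ is $\gamma=1/t^2$). In round $t$ the arm $A_t$ is a minimizer over $a\in\mathcal{A}_t$, with ties broken arbitrarily, of the index $$I_{t,a}=\frac{\hat\Delta_{t,a}^2}{\beta_{t-1}\|x_{t,a}\|_{V_{t-1}^{-1}}^2}-\log\big(\beta_{t-1}\|x_{t,a}\|_{V_{t-1}^{-1}}^2\big),\qquad \hat\Delta_{t,a}=\max_{j\in\mathcal{A}_t}\langle\hat\theta_{t-1},x_{t,j}\rangle-\langle\hat\theta_{t-1},x_{t,a}\rangle,$$ where $I_{t,a}=+\infty$ if $x_{t,a}=0$; it is part of the definition that $\max_{j\in\mathcal{A}_t}\langle\hat\theta_{t-1},x_{t,j}\rangle$ is finite and that a minimizer exists. **Theorem.** Assume that $\|X_t\|\le L$ almost surely for all $t\ge1$, $\|\theta^*\|\le S$, $\Delta_{t,b}\le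 1$ and $\langle\theta^*,x_{t,b}\rangle\ge 0$ for all $t\ge 1$ and $b\in\mathcal{A}_t$, and $\sqrt{\lambda}\,S\ge 1$. Then the regret of LinIMED-1 satisfies $R_T= O\big(d\sqrt{T}\log^{3/2}T\big)$: there is a constant $C$, depending only on $\lambda,R,S,L$, such that for every dimension $d$, every such bandit and every $T\ge 2$, $$R_T\le C\,d\sqrt{T}\,\log^{3/2}T .$$ -/

import Mathlib

universe u v

namespace LinIMED

open MeasureTheory

noncomputable section

/-- The regularized design matrix: `V₀ = λ I`, `Vₜ = Vₜ₋₁ + Xₜ Xₜᵀ`, along a sequence of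
contexts `X₁, X₂, …` (the entry `X 0` is not used). -/
def designMatrix {d : ℕ} (lam : ℝ) (X : ℕ → EuclideanSpace ℝ (Fin d)) :
    ℕ → Matrix (Fin d) (Fin d) ℝ
  | 0 => lam • (1 : Matrix (Fin d) (Fin d) ℝ)
  | t + 1 => designMatrix lam X t + Matrix.vecMulVec (X (t + 1)) (X (t + 1))

/-- `W₀ = 0`, `Wₜ = Wₜ₋₁ + Yₜ Xₜ`. -/
def responseVector {d : ℕ} (X : ℕ → EuclideanSpace ℝ (Fin d)) (Y : ℕ → ℝ) :
    ℕ → EuclideanSpace ℝ (Fin d)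
  | 0 => 0
  | t + 1 => responseVector X Y t + Y (t + 1) • X (t + 1)

/-- The ridge regression estimate `θ̂ₜ = Vₜ⁻¹ Wₜ`. -/
def ridgeEstimate {d : ℕ} (lam : ℝ) (X : ℕ → EuclideanSpace ℝ (Fin d)) (Y : ℕ → ℝ) (t : ℕ) :
    EuclideanSpace ℝ (Fin d) :=
  WithLp.toLp 2 ((designMatrix lam X t)⁻¹.mulVec (responseVector X Y t))

/-- The squared Mahalanobis norm `‖x‖²_{V⁻¹} = xᵀ V⁻¹ x`. -/
def sqInvNorm {d : ℕ} (V : Matrix (Fin d) (Fin d) ℝ) (x : EuclideanSpace ℝ (Fin d)) : ℝ :=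
  dotProduct (x : Fin d → ℝ) (V⁻¹.mulVec x)

/-- The confidence width
`βₙ(γ) = (R √(d log((1 + n L² / λ) / γ)) + √λ S)²`. -/
def confWidth (d : ℕ) (lam R S L : ℝ) (n : ℕ) (γ : ℝ) : ℝ :=
  (R * Real.sqrt (d * Real.log ((1 + n * L ^ 2 / lam) / γ)) + Real.sqrt lam * S) ^ 2

/-- The index `Δ̂² / (β ‖x‖²_{V⁻¹}) - log (β ‖x‖²_{V⁻¹})` of an arm with context `x` and empirical
gap `Δ̂`.  It is `+∞` when `‖x‖_{V⁻¹} = 0`, since `-log 0 = +∞`.  For an empirically best arm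
`Δ̂ = 0`, and the index is `-log (β ‖x‖²_{V⁻¹})`. -/
def index {d : ℕ} (V : Matrix (Fin d) (Fin d) ℝ) (β gap : ℝ) (x : EuclideanSpace ℝ (Fin d)) :
    EReal :=
  if sqInvNorm V x = 0 then ⊤
  else ((gap ^ 2 / (β * sqInvNorm V x) - Real.log (β * sqInvNorm V x) : ℝ) : EReal)

/-- `a` is an arm of the arm set `𝒜` of minimal LinIMED-1 index, where arm `j` has context `x j`,
the current design matrix is `V`, the current estimate is `θhat` and the confidence width is `β`.
The empirical gap of `j` is `m - ⟨θhat, x j⟩`, where `m` is the largest empirical reward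
(a finite supremum, which need not be attained when the arm set is infinite). -/
def IsMinIndexArm {ι : Type v} {d : ℕ} (𝒜 : Set ι) (x : ι → EuclideanSpace ℝ (Fin d))
    (V : Matrix (Fin d) (Fin d) ℝ) (θhat : EuclideanSpace ℝ (Fin d)) (β : ℝ) (a : ι) : Prop :=
  a ∈ 𝒜 ∧ ∃ m : ℝ, IsLUB ((fun j => inner ℝ θhat (x j)) '' 𝒜) m ∧
    ∀ b ∈ 𝒜, index V β (m - inner ℝ θhat (x a)) (x a) ≤ index V β (m - inner ℝ θhat (x b)) (x b)

/-- The arms `A` and the rewards `Y` of one realization are produced by LinIMED-1: in each round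
`t ≥ 1` the arm `A t` has minimal index (ties being broken arbitrarily) with respect to
`V_{t-1}`, `θ̂_{t-1}` and `β_{t-1}(γ)`, where the concentration parameter is `γ = 1 / t²`. -/
def IsRun {ι : Type v} {d : ℕ} (lam R S L : ℝ) (𝒜 : ℕ → Set ι)
    (x : ℕ → ι → EuclideanSpace ℝ (Fin d)) (A : ℕ → ι) (Y : ℕ → ℝ) : Prop :=
  ∀ t : ℕ, 1 ≤ t →
    IsMinIndexArm (𝒜 t) (x t)
      (designMatrix lam (fun s => x s (A s)) (t - 1))
      (ridgeEstimate lam (fun s => x s (A s)) Y (t - 1))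
      (confWidth d lam R S L (t - 1) (1 / (t : ℝ) ^ 2))
      (A t)

/-- The σ-algebra generated by `A₁, …, Aₜ, Y₁, …, Yₜ₋₁`. -/
@[reducible] def history {Ω : Type u} {ι : Type v} [MeasurableSpace ι] (A : ℕ → Ω → ι) (Y : ℕ → Ω → ℝ)
    (t : ℕ) : MeasurableSpace Ω :=
  (⨆ s ∈ Finset.Icc 1 t, MeasurableSpace.comap (A s) inferInstance) ⊔
    (⨆ s ∈ Finset.Ico 1 t, MeasurableSpace.comap (Y s) inferInstance)

/-- Conditionally on `m`, the random variable `η` is `R`-sub-Gaussian: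
`E[exp (s η) | m] ≤ exp (s² R² / 2)` almost surely, for every real `s`. -/
def IsCondSubGaussian {Ω : Type u} [MeasurableSpace Ω] (μ : Measure Ω) (m : MeasurableSpace Ω)
    (η : Ω → ℝ) (R : ℝ) : Prop :=
  ∀ s : ℝ, Integrable (fun ω => Real.exp (s * η ω)) μ ∧
    condExp m μ (fun ω => Real.exp (s * η ω)) ≤ᵐ[μ] fun _ => Real.exp (s ^ 2 * R ^ 2 / 2)

/-- The gap `Δ = max_{a ∈ 𝒜} ⟨θ, x a⟩ - ⟨θ, x b⟩` of the arm `b`. -/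
def gap {ι : Type v} {d : ℕ} (θ : EuclideanSpace ℝ (Fin d)) (𝒜 : Set ι)
    (x : ι → EuclideanSpace ℝ (Fin d)) (b : ι) : ℝ :=
  sSup ((fun a => inner ℝ θ (x a)) '' 𝒜) - inner ℝ θ (x b)

/-- The regret `∑_{t=1}^T (max_a ⟨θ, x_{t,a}⟩ - ⟨θ, X_t⟩)` of one realization. -/
def pathRegret {ι : Type v} {d : ℕ} (θ : EuclideanSpace ℝ (Fin d)) (𝒜 : ℕ → Set ι)
    (x : ℕ → ι → EuclideanSpace ℝ (Fin d)) (A : ℕ → ι) (T : ℕ) : ℝ :=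
  ∑ t ∈ Finset.Icc 1 T, gap θ (𝒜 t) (x t) (A t)

end

end LinIMED

/-!
The regret in a round is bounded by the confidence width of the pulled arm, and the widths are then
summed by the elliptical potential lemma. Write `w b = β ‖x b‖²_{V⁻¹}` for the squared confidence
width of an arm `b`, so that on the confidence event the empirical reward of `b` is within
`√(w b)` of its mean.

*The index.* Let `b` be a nearly optimal arm. Either `b` itself or an empirically almost best arm,
whichever is wider, has index at most `16 - log (w b)`, so the pulled arm `a` does as well
(`index_le_of_isMinIndexArm`). If neither `w a` nor `w b` is comparable to the squared gap `Δ²`, the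
empirical gap of `a` is of order `Δ`, and the index bound reads `Δ² / w a ≲ 1 + log (w a / w b)`.
The ratio in the logarithm is at most polynomial in `t`: since all means are nonnegative, `b` has
mean at least about `Δ`, hence a context of norm at least about `Δ / S`, and the eigenvalues of `V`
grow at most linearly. So `Δ² ≲ w a log t` in all cases (`sq_gap_le_of_isMinIndexArm`). Only the
context of the pulled arms needs to be bounded for this.

*The confidence event.* With `N` the accumulated noise vector, the process
`√(λᵈ / det V) exp (‖N‖²_{V⁻¹} / (2 R²))` has expectation at most one
(`lintegral_mixtureProcess_le_one`). By the Sherman–Morrison formula its successive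
ratios are one-dimensional Gaussian mixtures of `exp (s η - s² R² / 2)` whose parameters depend on the past;
since `s` is then random, the sub-Gaussian bound is applied under a regular conditional
distribution of the noise. Markov's inequality at level `t` and `det V ≤ (λ + n L²)ᵈ` give failure
probability at most `1 / t` in round `t` (`measure_noise_gt_le`). As the gaps are at most one, the
failures cost at most `∑ 1 / t ≤ 1 + log T` in expectation.

*Summation.* On the confidence events, Cauchy–Schwarz and the elliptical potential lemma bound the
regret by the square root of `T · log T · β · d log T` up to a constant, where `β` is of order
`d log T` (`pathRegret_le`).
-/

namespace LinIMED

open MeasureTheory Matrix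

/-! ### Quadratic forms and rank-one updates -/

section QuadraticForms

variable {n : Type*} [Fintype n]

theorem dotProduct_mulVec_comm_of_isHermitian {M : Matrix n n ℝ} (hM : M.IsHermitian)
    (u v : n → ℝ) : u ⬝ᵥ M *ᵥ v = v ⬝ᵥ M *ᵥ u := by
  have h : Mᵀ = M := by simpa [Matrix.IsHermitian, conjTranspose_eq_transpose_of_trivial] using hM
  rw [dotProduct_mulVec, ← mulVec_transpose, h, dotProduct_comm]

/-- The Cauchy–Schwarz inequality for a positive semidefinite form. -/
theorem sq_dotProduct_mulVec_le {M : Matrix n n ℝ} (hM : M.PosSemidef) (u v : n → ℝ) :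
    (u ⬝ᵥ M *ᵥ v) ^ 2 ≤ (u ⬝ᵥ M *ᵥ u) * (v ⬝ᵥ M *ᵥ v) := by
  have h : ∀ t : ℝ, 0 ≤ (v ⬝ᵥ M *ᵥ v) * (t * t) + (2 * (u ⬝ᵥ M *ᵥ v)) * t + (u ⬝ᵥ M *ᵥ u) := by
    intro t
    have h0 := hM.dotProduct_mulVec_nonneg (u + t • v)
    have hc := dotProduct_mulVec_comm_of_isHermitian hM.1 u v
    simp only [star_trivial, mulVec_add, mulVec_smul, dotProduct_add, add_dotProduct,
      dotProduct_smul, smul_dotProduct, smul_eq_mul] at h0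
    rw [← hc] at h0
    linarith
  have := discrim_le_zero h
  rw [discrim] at this
  nlinarith

theorem sqrt_dotProduct_mulVec_add_le {M : Matrix n n ℝ} (hM : M.PosSemidef) (u v : n → ℝ) :
    √((u + v) ⬝ᵥ M *ᵥ (u + v)) ≤ √(u ⬝ᵥ M *ᵥ u) + √(v ⬝ᵥ M *ᵥ v) := by
  have hu : 0 ≤ u ⬝ᵥ M *ᵥ u := by simpa using hM.dotProduct_mulVec_nonneg u
  have hv : 0 ≤ v ⬝ᵥ M *ᵥ v := by simpa using hM.dotProduct_mulVec_nonneg v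
  apply Real.sqrt_le_iff.2 ⟨by positivity, ?_⟩
  have hcs := Real.abs_le_sqrt (sq_dotProduct_mulVec_le hM u v)
  rw [Real.sqrt_mul hu] at hcs
  have hc := dotProduct_mulVec_comm_of_isHermitian hM.1 u v
  simp only [mulVec_add, dotProduct_add, add_dotProduct]
  rw [← hc]
  have h1 := Real.sq_sqrt hu
  have h2 := Real.sq_sqrt hv
  have h3 := le_abs_self (u ⬝ᵥ M *ᵥ v)
  nlinarith

theorem posDef_add_vecMulVec {V : Matrix n n ℝ} (hV : V.PosDef) (x : n → ℝ) :
    (V + vecMulVec x x).PosDef :=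
  hV.add_posSemidef (by simpa using posSemidef_vecMulVec_self_star x)

variable [DecidableEq n]

theorem mulVec_inv_mulVec {V : Matrix n n ℝ} (hV : V.PosDef) (u : n → ℝ) : V *ᵥ V⁻¹ *ᵥ u = u := by
  rw [mulVec_mulVec, mul_nonsing_inv _ ((isUnit_iff_isUnit_det V).1 hV.isUnit), one_mulVec]

theorem inv_mulVec_mulVec {V : Matrix n n ℝ} (hV : V.PosDef) (u : n → ℝ) : V⁻¹ *ᵥ V *ᵥ u = u := by
  rw [mulVec_mulVec, nonsing_inv_mul _ ((isUnit_iff_isUnit_det V).1 hV.isUnit), one_mulVec]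

/-- Cauchy–Schwarz for the pair of dual norms attached to `V` and `V⁻¹`. -/
theorem sq_dotProduct_le_inv_mul {V : Matrix n n ℝ} (hV : V.PosDef) (u v : n → ℝ) :
    (u ⬝ᵥ v) ^ 2 ≤ (u ⬝ᵥ V⁻¹ *ᵥ u) * (v ⬝ᵥ V *ᵥ v) := by
  have h := sq_dotProduct_mulVec_le hV.posSemidef v (V⁻¹ *ᵥ u)
  rw [mulVec_inv_mulVec hV, dotProduct_comm (V⁻¹ *ᵥ u), dotProduct_comm v] at h
  linarith

theorem dotProduct_self_le_mul_inv {V : Matrix n n ℝ} (hV : V.PosDef) {c : ℝ} (hc : 0 ≤ c)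
    {u : n → ℝ} (h : u ⬝ᵥ V *ᵥ u ≤ c * (u ⬝ᵥ u)) : u ⬝ᵥ u ≤ c * (u ⬝ᵥ V⁻¹ *ᵥ u) := by
  have h1 := sq_dotProduct_le_inv_mul hV u u
  have h2 : 0 ≤ u ⬝ᵥ V⁻¹ *ᵥ u := by simpa using hV.inv.posSemidef.dotProduct_mulVec_nonneg u
  have h3 : 0 ≤ u ⬝ᵥ u := by simpa using dotProduct_star_self_nonneg u
  rcases h3.eq_or_lt with h4 | h4
  · rw [← h4]; positivity
  · nlinarith [mul_le_mul_of_nonneg_left h h2]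

theorem mul_inv_le_dotProduct_self {V : Matrix n n ℝ} (hV : V.PosDef) {c : ℝ} (hc : 0 ≤ c)
    (h : ∀ u, c * (u ⬝ᵥ u) ≤ u ⬝ᵥ V *ᵥ u) (u : n → ℝ) :
    c * (u ⬝ᵥ V⁻¹ *ᵥ u) ≤ u ⬝ᵥ u := by
  have h1 := h (V⁻¹ *ᵥ u)
  rw [mulVec_inv_mulVec hV, dotProduct_comm (V⁻¹ *ᵥ u) u] at h1
  have h2 : 0 ≤ u ⬝ᵥ V⁻¹ *ᵥ u := by simpa using hV.inv.posSemidef.dotProduct_mulVec_nonneg u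
  have h3 : 0 ≤ u ⬝ᵥ u := by simpa using dotProduct_star_self_nonneg u
  have h4 := sq_dotProduct_mulVec_le (PosSemidef.one (n := n) (R := ℝ)) u (V⁻¹ *ᵥ u)
  simp only [one_mulVec] at h4
  rcases h2.eq_or_lt with h5 | h5
  · rw [← h5]; simpa using h3
  · refine le_of_mul_le_mul_left ?_ h5
    nlinarith [mul_le_mul_of_nonneg_left h1 h3, mul_le_mul_of_nonneg_left h4 hc]

theorem det_add_vecMulVec_self {V : Matrix n n ℝ} (hV : V.PosDef) (x : n → ℝ) :
    (V + vecMulVec x x).det = V.det * (1 + x ⬝ᵥ V⁻¹ *ᵥ x) := by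
  rw [vecMulVec_eq Unit, det_add_replicateCol_mul_replicateRow
    ((isUnit_iff_isUnit_det V).1 hV.isUnit)]
  congr 1
  simp only [det_unique, Matrix.add_apply, one_apply_eq]
  rw [dotProduct_mulVec]
  simp [Matrix.mul_apply, dotProduct, vecMul]

/-- The Sherman–Morrison formula, in the form in which it updates the dual norm of the noise
vector `u` when the observation `e • x` is added. -/
theorem add_smul_inv_add_vecMulVec {V : Matrix n n ℝ} (hV : V.PosDef) (x u : n → ℝ) (e : ℝ) :
    (u + e • x) ⬝ᵥ (V + vecMulVec x x)⁻¹ *ᵥ (u + e • x) =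
      u ⬝ᵥ V⁻¹ *ᵥ u + (2 * e * (x ⬝ᵥ V⁻¹ *ᵥ u) + e ^ 2 * (x ⬝ᵥ V⁻¹ *ᵥ x)
        - (x ⬝ᵥ V⁻¹ *ᵥ u) ^ 2) / (1 + x ⬝ᵥ V⁻¹ *ᵥ x) := by
  have hw : 0 ≤ x ⬝ᵥ V⁻¹ *ᵥ x := by simpa using hV.inv.posSemidef.dotProduct_mulVec_nonneg x
  have hw' : (1 + x ⬝ᵥ V⁻¹ *ᵥ x) ≠ 0 := by positivity
  set w := x ⬝ᵥ V⁻¹ *ᵥ x with hwdef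
  set p := x ⬝ᵥ V⁻¹ *ᵥ u with hpdef
  set c := (p + e * w) / (1 + w) with hcdef
  have hz : (V + vecMulVec x x) *ᵥ (V⁻¹ *ᵥ (u + e • x) - c • V⁻¹ *ᵥ x) = u + e • x := by
    have hx : ∀ y : n → ℝ, vecMulVec x x *ᵥ y = (x ⬝ᵥ y) • x := by
      intro y
      rw [vecMulVec_mulVec]
      ext i; simp [mul_comm]
    simp only [mulVec_sub, add_mulVec, mulVec_smul, mulVec_inv_mulVec hV, hx, mulVec_add,
      ← hwdef, ← hpdef]
    ext i
    simp only [Pi.add_apply, Pi.sub_apply, Pi.smul_apply, smul_eq_mul]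
    rw [hcdef]
    field_simp
    ring
  have hinv : (V + vecMulVec x x)⁻¹ *ᵥ (u + e • x) = V⁻¹ *ᵥ (u + e • x) - c • V⁻¹ *ᵥ x := by
    conv_lhs => rw [← hz]
    rw [inv_mulVec_mulVec (posDef_add_vecMulVec hV x)]
  have hp' : u ⬝ᵥ V⁻¹ *ᵥ x = p := dotProduct_mulVec_comm_of_isHermitian hV.inv.1 u x
  rw [hinv]
  simp only [mulVec_add, mulVec_smul, dotProduct_add, dotProduct_sub, add_dotProduct,
    dotProduct_smul, smul_dotProduct, smul_eq_mul, ← hwdef, ← hpdef, hp']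
  rw [hcdef]
  field_simp
  ring

/-- If all eigenvalues are at most `c`, the determinant is at most `c ^ card n`. -/
theorem det_le_pow_card {V : Matrix n n ℝ} (hV : V.PosSemidef) {c : ℝ}
    (h : ∀ u, u ⬝ᵥ V *ᵥ u ≤ c * (u ⬝ᵥ u)) : V.det ≤ c ^ Fintype.card n := by
  rw [hV.1.det_eq_prod_eigenvalues, ← Finset.card_univ, ← Finset.prod_const]
  refine Finset.prod_le_prod (fun i _ => hV.eigenvalues_nonneg i) fun i _ => ?_
  have h1 := h (hV.1.eigenvectorBasis i)
  rw [hV.1.mulVec_eigenvectorBasis i, dotProduct_smul] at h1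
  have h2 : (hV.1.eigenvectorBasis i).ofLp ⬝ᵥ (hV.1.eigenvectorBasis i).ofLp = 1 := by
    have := hV.1.eigenvectorBasis.orthonormal.1 i
    rw [EuclideanSpace.norm_eq, Real.sqrt_eq_one] at this
    simpa [dotProduct, sq] using this
  simpa [h2] using h1

end QuadraticForms

/-! ### The design matrix and the elliptical potential -/

section DesignMatrix

variable {d : ℕ} {lam : ℝ}

theorem designMatrix_posDef (hlam : 0 < lam) (X : ℕ → EuclideanSpace ℝ (Fin d)) (t : ℕ) :
    (designMatrix lam X t).PosDef := by
  induction t with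
  | zero => exact PosDef.one.smul hlam
  | succ t ih => exact posDef_add_vecMulVec ih _

theorem dotProduct_ofLp (u v : EuclideanSpace ℝ (Fin d)) :
    u.ofLp ⬝ᵥ v.ofLp = inner ℝ u v := by
  simp [PiLp.inner_apply, dotProduct, mul_comm]

theorem sqInvNorm_nonneg {V : Matrix (Fin d) (Fin d) ℝ} (hV : V.PosDef)
    (x : EuclideanSpace ℝ (Fin d)) : 0 ≤ sqInvNorm V x := by
  simpa [sqInvNorm] using hV.inv.posSemidef.dotProduct_mulVec_nonneg x.ofLp

theorem mul_norm_sq_le_designMatrix (X : ℕ → EuclideanSpace ℝ (Fin d)) (t : ℕ) (u : Fin d → ℝ) :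
    lam * (u ⬝ᵥ u) ≤ u ⬝ᵥ designMatrix lam X t *ᵥ u := by
  induction t with
  | zero => simp [designMatrix, smul_mulVec]
  | succ t ih =>
    have h := (posSemidef_vecMulVec_self_star (X (t + 1)).ofLp).dotProduct_mulVec_nonneg u
    simp only [star_trivial] at h
    rw [designMatrix, add_mulVec, dotProduct_add]
    linarith

theorem designMatrix_le_mul_norm_sq {X : ℕ → EuclideanSpace ℝ (Fin d)} {L : ℝ} {t : ℕ}
    (hX : ∀ s ∈ Finset.Icc 1 t, ‖X s‖ ≤ L) (u : Fin d → ℝ) :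
    u ⬝ᵥ designMatrix lam X t *ᵥ u ≤ (lam + t * L ^ 2) * (u ⬝ᵥ u) := by
  induction t with
  | zero => simp [designMatrix, smul_mulVec]
  | succ t ih =>
    have ih := ih fun s hs => hX s (by simp at hs ⊢; omega)
    have h0 := hX (t + 1) (by simp)
    have h1 : ((X (t + 1)).ofLp ⬝ᵥ u) ^ 2 ≤ L ^ 2 * (u ⬝ᵥ u) := by
      have h2 := sq_dotProduct_mulVec_le (PosSemidef.one (n := Fin d) (R := ℝ)) (X (t + 1)).ofLp u
      simp only [one_mulVec] at h2
      refine h2.trans (mul_le_mul_of_nonneg_right ?_ (by simpa using dotProduct_star_self_nonneg u))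
      rw [dotProduct_ofLp, real_inner_self_eq_norm_sq]
      gcongr
    have h3 : u ⬝ᵥ vecMulVec (X (t + 1)).ofLp (X (t + 1)).ofLp *ᵥ u
        = ((X (t + 1)).ofLp ⬝ᵥ u) ^ 2 := by
      rw [vecMulVec_mulVec]
      simp only [op_smul_eq_smul, dotProduct_smul, smul_eq_mul]
      rw [dotProduct_comm u]; ring
    rw [designMatrix, add_mulVec, dotProduct_add, h3]
    push_cast
    linarith

theorem det_designMatrix_succ (hlam : 0 < lam) (X : ℕ → EuclideanSpace ℝ (Fin d)) (t : ℕ) :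
    (designMatrix lam X (t + 1)).det =
      (designMatrix lam X t).det * (1 + sqInvNorm (designMatrix lam X t) (X (t + 1))) :=
  det_add_vecMulVec_self (designMatrix_posDef hlam X t) _

theorem log_det_designMatrix_le (hlam : 0 < lam) {X : ℕ → EuclideanSpace ℝ (Fin d)} {L : ℝ} {t : ℕ}
    (hX : ∀ s ∈ Finset.Icc 1 t, ‖X s‖ ≤ L) :
    Real.log ((designMatrix lam X t).det / lam ^ d) ≤ d * Real.log (1 + t * L ^ 2 / lam) := by
  have hV := designMatrix_posDef hlam X t
  have h := det_le_pow_card hV.posSemidef (designMatrix_le_mul_norm_sq (lam := lam) hX)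
  rw [Fintype.card_fin] at h
  rw [← Real.log_pow]
  refine Real.log_le_log (div_pos hV.det_pos (by positivity)) ?_
  rw [show 1 + t * L ^ 2 / lam = (lam + t * L ^ 2) / lam by field_simp, div_pow]
  gcongr

/-- The elliptical potential lemma. -/
theorem sum_min_one_sqInvNorm_le (hlam : 0 < lam) (X : ℕ → EuclideanSpace ℝ (Fin d)) (T : ℕ) :
    ∑ t ∈ Finset.Icc 1 T, min 1 (sqInvNorm (designMatrix lam X (t - 1)) (X t)) ≤
      2 * Real.log ((designMatrix lam X T).det / lam ^ d) := by
  induction T with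
  | zero => simp [designMatrix, hlam.ne']
  | succ T ih =>
    have hV := (designMatrix_posDef hlam X T).det_pos
    have hw := sqInvNorm_nonneg (designMatrix_posDef hlam X T) (X (T + 1))
    rw [Finset.sum_Icc_succ_top (by omega), det_designMatrix_succ hlam, Nat.add_sub_cancel]
    set w := sqInvNorm (designMatrix lam X T) (X (T + 1))
    have hlog : min 1 w ≤ 2 * Real.log (1 + w) := by
      -- `log (1 + v) ≥ v / (1 + v) ≥ v / 2` at `v = min 1 w`
      have hv : 0 ≤ min 1 w := le_min zero_le_one hw
      have h1 : Real.log (1 + min 1 w) ≤ Real.log (1 + w) :=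
        Real.log_le_log (by positivity) (by gcongr; exact min_le_right _ _)
      have h2 := Real.one_sub_inv_le_log_of_pos (show 0 < 1 + min 1 w by positivity)
      have h3 : min 1 w / 2 ≤ 1 - (1 + min 1 w)⁻¹ := by
        have h4 : min 1 w ≤ 1 := min_le_left _ _
        rw [show 1 - (1 + min 1 w)⁻¹ = min 1 w / (1 + min 1 w) by field_simp; ring]
        gcongr
        linarith
      linarith
    rw [mul_div_right_comm, Real.log_mul (by positivity) (by positivity)]
    linarith

end DesignMatrix

/-! ### The gap of an arm of minimal index -/

section MinIndex

variable {ι : Type v} {d : ℕ} {𝒜 : Set ι} {x : ι → EuclideanSpace ℝ (Fin d)}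
  {V : Matrix (Fin d) (Fin d) ℝ} {θ θhat : EuclideanSpace ℝ (Fin d)} {β κ : ℝ} {a : ι}

theorem index_eq_of_pos {w g : ℝ} {y : EuclideanSpace ℝ (Fin d)} (hw : w = β * sqInvNorm V y)
    (hpos : 0 < w) : index V β g y = ((g ^ 2 / w - Real.log w : ℝ) : EReal) := by
  have : sqInvNorm V y ≠ 0 := by
    rintro h
    rw [h, mul_zero] at hw
    exact hpos.ne' hw
  rw [index, if_neg this, hw]

/-- An upper bound on the index of the pulled arm in terms of the width `w b` of a nearly optimal
arm `b`.  It is the index of `b` if `b` is at least as wide as an empirically (almost) best arm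
`e`, and the index of `e` otherwise. -/
theorem index_le_of_isMinIndexArm (hV : V.PosDef) (hβ : 0 < β)
    (hconf : ∀ j ∈ 𝒜, |inner ℝ θhat (x j) - inner ℝ θ (x j)| ≤ √(β * sqInvNorm V (x j)))
    {m : ℝ} (hm : IsLUB ((fun j => inner ℝ θhat (x j)) '' 𝒜) m)
    (hmin : ∀ b ∈ 𝒜,
      index V β (m - inner ℝ θhat (x a)) (x a) ≤ index V β (m - inner ℝ θhat (x b)) (x b))
    {b : ι} (hb : b ∈ 𝒜) (hwb : 0 < β * sqInvNorm V (x b))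
    (hopt : ∀ j ∈ 𝒜, inner ℝ θ (x j) ≤ inner ℝ θ (x b) + √(β * sqInvNorm V (x b))) :
    index V β (m - inner ℝ θhat (x a)) (x a) ≤
      ((16 - Real.log (β * sqInvNorm V (x b)) : ℝ) : EReal) := by
  set w : ι → ℝ := fun j => β * sqInvNorm V (x j) with hw
  have hw0 : ∀ j, 0 ≤ w j := fun j => mul_nonneg hβ.le (sqInvNorm_nonneg hV _)
  change 0 < w b at hwb
  change _ ≤ ((16 - Real.log (w b) : ℝ) : EReal)
  have hsb : 0 < √(w b) := Real.sqrt_pos.2 hwb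
  obtain ⟨_, ⟨e, he, rfl⟩, hme, -⟩ := hm.exists_between (sub_lt_self m hsb)
  have hme' : inner ℝ θhat (x e) ≤ m := hm.1 ⟨e, he, rfl⟩
  have hmb : inner ℝ θhat (x b) ≤ m := hm.1 ⟨b, hb, rfl⟩
  simp only at hme
  have hsq : √(w b) ^ 2 = w b := Real.sq_sqrt (hw0 b)
  rcases le_or_gt (w e) (w b) with h | h
  · refine (hmin b hb).trans ?_
    rw [index_eq_of_pos rfl hwb, EReal.coe_le_coe_iff]
    have h1 : √(w e) ≤ √(w b) := Real.sqrt_le_sqrt h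
    have h2 := abs_le.1 (hconf e he)
    have h3 := abs_le.1 (hconf b hb)
    have h4 := hopt e he
    change _ ∧ _ ≤ √(w e) at h2
    change -√(w b) ≤ _ ∧ _ at h3
    change _ ≤ _ + √(w b) at h4
    have h5 : m - inner ℝ θhat (x b) ≤ 4 * √(w b) := by linarith [h2.2, h3.1]
    have h6 : (m - inner ℝ θhat (x b)) ^ 2 / w b ≤ 16 := by
      rw [div_le_iff₀ hwb]
      nlinarith
    change (m - inner ℝ θhat (x b)) ^ 2 / w b - Real.log (w b) ≤ 16 - Real.log (w b)
    linarith
  · have hwe : 0 < w e := hwb.trans h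
    refine (hmin e he).trans ?_
    rw [index_eq_of_pos rfl hwe, EReal.coe_le_coe_iff]
    have h6 : (m - inner ℝ θhat (x e)) ^ 2 / w e ≤ 16 := by
      rw [div_le_iff₀ hwe]
      nlinarith
    have h7 := Real.log_le_log hwb h.le
    change (m - inner ℝ θhat (x e)) ^ 2 / w e - Real.log (w e) ≤ 16 - Real.log (w b)
    linarith

/-- On the confidence event, the gap of the pulled arm is controlled by its own confidence width,
up to a logarithmic factor.  The hypothesis `hκ` says that an arm with a large mean
reward cannot have a tiny confidence width. -/
theorem sq_gap_le_of_isMinIndexArm (hV : V.PosDef) (hβ : 0 < β) (hκ1 : 1 ≤ κ)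
    (hconf : ∀ j ∈ 𝒜, |inner ℝ θhat (x j) - inner ℝ θ (x j)| ≤ √(β * sqInvNorm V (x j)))
    (hκ : ∀ j, (inner ℝ θ (x j)) ^ 2 ≤ κ * (β * sqInvNorm V (x j)))
    (ha : IsMinIndexArm 𝒜 x V θhat β a)
    (hbdd : BddAbove ((fun j => inner ℝ θ (x j)) '' 𝒜))
    (hnonneg : ∀ j ∈ 𝒜, 0 ≤ inner ℝ θ (x j)) :
    gap θ 𝒜 x a ^ 2 ≤
      (64 * Real.exp 16 + 256 + 16 * Real.log κ) * (β * sqInvNorm V (x a)) := by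
  obtain ⟨haA, m, hm, hmin⟩ := ha
  set w : ι → ℝ := fun j => β * sqInvNorm V (x j) with hw
  have hw0 : ∀ j, 0 ≤ w j := fun j => mul_nonneg hβ.le (sqInvNorm_nonneg hV _)
  change _ ≤ _ * w a
  have hlogκ : 0 ≤ Real.log κ := Real.log_nonneg hκ1
  have hK : 0 ≤ (64 * Real.exp 16 + 256 + 16 * Real.log κ) * w a := by
    have := hw0 a
    positivity
  set G := gap θ 𝒜 x a with hG
  have hlub : IsLUB ((fun j => inner ℝ θ (x j)) '' 𝒜) (sSup ((fun j => inner ℝ θ (x j)) '' 𝒜)) :=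
    isLUB_csSup ⟨_, a, haA, rfl⟩ hbdd
  have hGa : sSup ((fun j => inner ℝ θ (x j)) '' 𝒜) = G + inner ℝ θ (x a) := by
    rw [hG, gap]; ring
  rw [hGa] at hlub
  have hG0 : 0 ≤ G := by
    have : inner ℝ θ (x a) ≤ _ := hlub.1 ⟨a, haA, rfl⟩
    linarith
  rcases hG0.eq_or_lt with hG1 | hG1
  · rw [← hG1]; simpa using hK
  -- a nearly optimal arm `b`: within `G / 2` of the optimum and, since `√κ * √(w b) ≥ G / 2`,
  -- within its own confidence width
  set ε := min (G / 2) (G / (2 * √κ)) with hε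
  have hκ0 : 0 < √κ := Real.sqrt_pos.2 (by linarith)
  have hε0 : 0 < ε := lt_min (by linarith) (by positivity)
  obtain ⟨_, ⟨b, hb, rfl⟩, hbε, -⟩ := hlub.exists_between (sub_lt_self _ hε0)
  simp only at hbε
  set D := inner ℝ θ (x b) - inner ℝ θ (x a) with hD
  have hDG : G / 2 ≤ D := by
    have : ε ≤ G / 2 := min_le_left _ _
    linarith
  have hD0 : 0 < D := by linarith
  have hDb : D ^ 2 ≤ κ * w b := by
    refine le_trans ?_ (hκ b)
    have := hnonneg a haA
    gcongr
    linarith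
  have hwb : 0 < w b := by
    refine pos_of_mul_pos_right (lt_of_lt_of_le (by positivity) hDb) (by linarith)
  have hεb : ε ≤ √(w b) := by
    refine (min_le_right _ _).trans ?_
    rw [div_le_iff₀ (by positivity)]
    have h1 : D ≤ √(κ * w b) := Real.le_sqrt_of_sq_le hDb
    rw [Real.sqrt_mul (by linarith)] at h1
    linarith
  have hopt : ∀ j ∈ 𝒜, inner ℝ θ (x j) ≤ inner ℝ θ (x b) + √(w b) := by
    intro j hj
    have : inner ℝ θ (x j) ≤ _ := hlub.1 ⟨j, hj, rfl⟩
    linarith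
  have hI := index_le_of_isMinIndexArm hV hβ hconf hm hmin hb hwb hopt
  -- an arm of zero width has index `⊤` and is not pulled while `b` is available
  have hwa : 0 < w a := by
    refine (hw0 a).lt_of_ne fun h => ?_
    have h0 : sqInvNorm V (x a) = 0 := (mul_eq_zero.1 h.symm).resolve_left hβ.ne'
    rw [index, if_pos h0, top_le_iff] at hI
    exact EReal.coe_ne_top _ hI
  rw [index_eq_of_pos rfl hwa, EReal.coe_le_coe_iff] at hI
  change (m - inner ℝ θhat (x a)) ^ 2 / w a - Real.log (w a) ≤ 16 - Real.log (w b) at hI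
  have hGD : G ^ 2 ≤ 4 * D ^ 2 := by
    calc G ^ 2 ≤ (2 * D) ^ 2 := by gcongr; linarith
      _ = 4 * D ^ 2 := by ring
  have hsa := Real.sq_sqrt (hw0 a)
  have hsb := Real.sq_sqrt (hw0 b)
  have hsa0 := Real.sqrt_nonneg (w a)
  have hsb0 := Real.sqrt_nonneg (w b)
  have hexp : 1 ≤ Real.exp 16 := Real.one_le_exp (by norm_num)
  by_cases hc1 : D / 4 < √(w a)
  · have : D ^ 2 ≤ 16 * w a := by
      calc D ^ 2 ≤ (4 * √(w a)) ^ 2 := by gcongr; linarith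
        _ = 16 * w a := by rw [mul_pow, hsa]; norm_num
    linarith [mul_nonneg hlogκ hwa.le, mul_le_mul_of_nonneg_right hexp hwa.le]
  by_cases hc2 : D / 4 < √(w b)
  · have h1 : D ^ 2 ≤ 16 * w b := by
      calc D ^ 2 ≤ (4 * √(w b)) ^ 2 := by gcongr; linarith
        _ = 16 * w b := by rw [mul_pow, hsb]; norm_num
    have h2 : w b ≤ Real.exp 16 * w a := by
      have h3 : 0 ≤ (m - inner ℝ θhat (x a)) ^ 2 / w a := by positivity
      rw [← Real.exp_log hwb, ← Real.exp_log hwa, ← Real.exp_add]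
      gcongr
      linarith
    linarith [mul_nonneg hlogκ hwa.le]
  -- both widths are small, so that the empirical gap of the pulled arm is at least `D / 2`
  push Not at hc1 hc2
  have h1 := abs_le.1 (hconf a haA)
  have h2 := abs_le.1 (hconf b hb)
  change _ ∧ _ ≤ √(w a) at h1
  change -√(w b) ≤ _ ∧ _ at h2
  have hmb : inner ℝ θhat (x b) ≤ m := hm.1 ⟨b, hb, rfl⟩
  have h3 : D / 2 ≤ m - inner ℝ θhat (x a) := by linarith [h1.2, h2.1]
  have h4 : D ^ 2 / 4 ≤ (m - inner ℝ θhat (x a)) ^ 2 := by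
    calc D ^ 2 / 4 = (D / 2) ^ 2 := by ring
      _ ≤ _ := by gcongr
  have h5 : Real.log (w a) ≤ Real.log κ + Real.log (w b) := by
    rw [← Real.log_mul (by linarith) hwb.ne']
    refine Real.log_le_log hwa (le_trans ?_ hDb)
    rw [← hsa]
    gcongr
    linarith
  have h6 : (m - inner ℝ θhat (x a)) ^ 2 / w a ≤ 16 + Real.log κ := by linarith
  rw [div_le_iff₀ hwa] at h6
  linarith [mul_nonneg (Real.exp_nonneg 16) hwa.le]

end MinIndex

/-! ### The prediction error of ridge regression -/

section Confidence

variable {d : ℕ} {lam : ℝ}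

/-- The responses decompose as signal plus noise. -/
theorem responseVector_eq (X : ℕ → EuclideanSpace ℝ (Fin d)) (Y : ℕ → ℝ)
    (θ : EuclideanSpace ℝ (Fin d)) (n : ℕ) :
    (responseVector X Y n).ofLp = (responseVector X (fun t => Y t - inner ℝ θ (X t)) n).ofLp +
      (designMatrix lam X n *ᵥ θ.ofLp - lam • θ.ofLp) := by
  induction n with
  | zero => simp [responseVector, designMatrix, smul_mulVec]
  | succ n ih =>
    simp only [responseVector, designMatrix, WithLp.ofLp_add,
      WithLp.ofLp_smul, ih, add_mulVec, vecMulVec_mulVec, dotProduct_ofLp, real_inner_comm]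
    ext i
    simp only [Pi.add_apply, Pi.sub_apply, Pi.smul_apply, smul_eq_mul, MulOpposite.smul_eq_mul_unop,
      MulOpposite.unop_op]
    rw [real_inner_comm]
    ring

/-- The ridge estimate predicts the reward of every context up to its dual norm times the dual
norm of the accumulated noise, plus the regularization bias. -/
theorem abs_inner_ridgeEstimate_sub_le (hlam : 0 < lam) (X : ℕ → EuclideanSpace ℝ (Fin d))
    (Y : ℕ → ℝ) (θ : EuclideanSpace ℝ (Fin d)) {S : ℝ} (hθ : ‖θ‖ ≤ S) (n : ℕ)
    (y : EuclideanSpace ℝ (Fin d)) :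
    |inner ℝ (ridgeEstimate lam X Y n) y - inner ℝ θ y| ≤
      (√(sqInvNorm (designMatrix lam X n)
          (responseVector X (fun t => Y t - inner ℝ θ (X t)) n)) + √lam * S) *
        √(sqInvNorm (designMatrix lam X n) y) := by
  have hV := designMatrix_posDef hlam X n
  set V := designMatrix lam X n with hVdef
  set N := responseVector X (fun t => Y t - inner ℝ θ (X t)) n with hN
  have h1 : inner ℝ (ridgeEstimate lam X Y n) y - inner ℝ θ y =
      (N.ofLp + (-lam) • θ.ofLp) ⬝ᵥ V⁻¹ *ᵥ y.ofLp := by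
    rw [← dotProduct_ofLp, ← dotProduct_ofLp, ridgeEstimate, responseVector_eq (lam := lam) X Y θ,
      ← hVdef, ← hN, dotProduct_mulVec_comm_of_isHermitian hV.inv.1]
    simp only [mulVec_add, mulVec_sub, inv_mulVec_mulVec hV, dotProduct_comm y.ofLp,
      add_dotProduct, sub_dotProduct, neg_smul, mulVec_neg, neg_dotProduct]
    ring
  have h2 : sqInvNorm V θ ≤ S ^ 2 / lam := by
    have h3 := mul_inv_le_dotProduct_self hV hlam.le (mul_norm_sq_le_designMatrix X n) θ.ofLp
    rw [dotProduct_ofLp θ θ, real_inner_self_eq_norm_sq] at h3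
    rw [le_div_iff₀ hlam, mul_comm]
    exact h3.trans (by gcongr)
  have hS : 0 ≤ S := (norm_nonneg θ).trans hθ
  have h4 : √(((-lam) • θ.ofLp) ⬝ᵥ V⁻¹ *ᵥ ((-lam) • θ.ofLp)) ≤ √lam * S := by
    rw [mulVec_smul, dotProduct_smul, smul_dotProduct, smul_eq_mul, smul_eq_mul]
    refine Real.sqrt_le_iff.2 ⟨by positivity, ?_⟩
    rw [mul_pow, Real.sq_sqrt hlam.le]
    calc -lam * (-lam * sqInvNorm V θ) = lam ^ 2 * sqInvNorm V θ := by ring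
      _ ≤ lam ^ 2 * (S ^ 2 / lam) := by gcongr
      _ = lam * S ^ 2 := by field_simp
  rw [h1]
  refine (Real.abs_le_sqrt (sq_dotProduct_mulVec_le hV.inv.posSemidef _ _)).trans ?_
  rw [Real.sqrt_mul (by
    simpa only [star_trivial] using hV.inv.posSemidef.dotProduct_mulVec_nonneg _)]
  refine mul_le_mul_of_nonneg_right ?_ (Real.sqrt_nonneg _)
  refine (sqrt_dotProduct_mulVec_add_le hV.inv.posSemidef _ _).trans ?_
  exact add_le_add le_rfl h4

end Confidence

/-! ### Gaussian mixtures of exponential moments -/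

section GaussianMixture

open ProbabilityTheory
open scoped ENNReal NNReal

/-- A Gaussian mixture of the exponentials `exp (s y - s² R² / 2)`.  The prior on the tilt `s` has
mean `u / R²` and variance `w / R²`; completing the square in `s` turns its density into a multiple
of another Gaussian density. -/
theorem lintegral_exp_gaussianReal {R w : ℝ} (hR : 0 < R) (hw : 0 ≤ w) (u y : ℝ) :
    ∫⁻ s, ENNReal.ofReal (Real.exp (s * y - s ^ 2 * R ^ 2 / 2))
      ∂gaussianReal (u / R ^ 2) (w / R ^ 2).toNNReal =
    ENNReal.ofReal
      (Real.exp ((2 * y * u + y ^ 2 * w - u ^ 2) / (2 * R ^ 2 * (1 + w))) / √(1 + w)) := by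
  rcases hw.eq_or_lt with rfl | hw
  · rw [zero_div, Real.toNNReal_zero, gaussianReal_zero_var, lintegral_dirac]
    congr 1
    simp only [add_zero, Real.sqrt_one, div_one]
    congr 1
    field_simp
    ring
  · have hv : (w / R ^ 2).toNNReal ≠ 0 := by
      rw [Ne, Real.toNNReal_eq_zero, not_le]; positivity
    have hv' : (w / (R ^ 2 * (1 + w))).toNNReal ≠ 0 := by
      rw [Ne, Real.toNNReal_eq_zero, not_le]; positivity
    rw [gaussianReal_of_var_ne_zero _ hv,
      lintegral_withDensity_eq_lintegral_mul _ (measurable_gaussianPDF _ _) (by fun_prop)]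
    have key : ∀ s : ℝ, (gaussianPDF (u / R ^ 2) (w / R ^ 2).toNNReal *
        fun s => ENNReal.ofReal (Real.exp (s * y - s ^ 2 * R ^ 2 / 2))) s =
        ENNReal.ofReal
          (Real.exp ((2 * y * u + y ^ 2 * w - u ^ 2) / (2 * R ^ 2 * (1 + w))) / √(1 + w)) *
        gaussianPDF ((u + w * y) / (R ^ 2 * (1 + w))) (w / (R ^ 2 * (1 + w))).toNNReal s := by
      intro s
      rw [Pi.mul_apply, gaussianPDF, gaussianPDF,
        ← ENNReal.ofReal_mul (gaussianPDFReal_nonneg _ _ _), ← ENNReal.ofReal_mul (by positivity)]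
      congr 1
      simp only [gaussianPDFReal]
      rw [Real.coe_toNNReal _ (by positivity), Real.coe_toNNReal _ (by positivity)]
      have hs : √(2 * Real.pi * (w / R ^ 2)) =
          √(2 * Real.pi * (w / (R ^ 2 * (1 + w)))) * √(1 + w) := by
        rw [← Real.sqrt_mul (by positivity)]
        congr 1
        field_simp
      have he : Real.exp (-(s - u / R ^ 2) ^ 2 / (2 * (w / R ^ 2))) *
          Real.exp (s * y - s ^ 2 * R ^ 2 / 2) =
          Real.exp ((2 * y * u + y ^ 2 * w - u ^ 2) / (2 * R ^ 2 * (1 + w))) *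
          Real.exp (-(s - (u + w * y) / (R ^ 2 * (1 + w))) ^ 2 /
            (2 * (w / (R ^ 2 * (1 + w))))) := by
        rw [← Real.exp_add, ← Real.exp_add]
        congr 1
        field_simp
        ring
      rw [hs, mul_inv, mul_assoc, he]
      ring
    rw [lintegral_congr key, lintegral_const_mul _ (measurable_gaussianPDF _ _),
      lintegral_gaussianPDF_eq_one _ hv', mul_one]

/-- A sub-Gaussian law integrates the Gaussian mixture to at most one. -/
theorem lintegral_mixture_le_one {R w : ℝ} (hR : 0 < R) (hw : 0 ≤ w) (u : ℝ) {κ : Measure ℝ}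
    [SFinite κ]
    (hκ : ∀ s : ℝ, ∫⁻ y, ENNReal.ofReal (Real.exp (s * y)) ∂κ ≤
      ENNReal.ofReal (Real.exp (s ^ 2 * R ^ 2 / 2))) :
    ∫⁻ y, ENNReal.ofReal
      (Real.exp ((2 * y * u + y ^ 2 * w - u ^ 2) / (2 * R ^ 2 * (1 + w))) / √(1 + w)) ∂κ ≤ 1 := by
  simp_rw [← lintegral_exp_gaussianReal hR hw u]
  rw [lintegral_lintegral_swap (by fun_prop)]
  have h : ∀ s : ℝ, ∫⁻ y, ENNReal.ofReal (Real.exp (s * y - s ^ 2 * R ^ 2 / 2)) ∂κ ≤ 1 := by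
    intro s
    simp_rw [Real.exp_sub, div_eq_mul_inv, ENNReal.ofReal_mul (Real.exp_nonneg _)]
    rw [lintegral_mul_const _ (by fun_prop), ← Real.exp_neg]
    refine (mul_le_mul_left (hκ s) _).trans ?_
    rw [← ENNReal.ofReal_mul (Real.exp_nonneg _), ← Real.exp_add]
    simp [div_eq_mul_inv]
  exact (lintegral_mono h).trans (by simp)

variable {Ω : Type*} [MeasurableSpace Ω] {μ : Measure Ω} [IsProbabilityMeasure μ]

/-- The bounds on the conditional moment generating function, which hold almost surely for each
argument `s`, hold almost surely for all `s` at once for a regular conditional distribution. -/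
theorem ae_forall_lintegral_exp_condDistrib_le {β : Type*} {mβ : MeasurableSpace β} {X : Ω → β}
    (hX : Measurable X) {η : Ω → ℝ} (hη : Measurable η) {R : ℝ}
    (h : IsCondSubGaussian μ (mβ.comap X) η R) :
    ∀ᵐ ω ∂μ, ∀ s : ℝ, ∫⁻ y, ENNReal.ofReal (Real.exp (s * y)) ∂condDistrib η X μ (X ω) ≤
      ENNReal.ofReal (Real.exp (s ^ 2 * R ^ 2 / 2)) := by
  have hrat : ∀ᵐ ω ∂μ, ∀ q : ℚ,
      ∫⁻ y, ENNReal.ofReal (Real.exp (q * y)) ∂condDistrib η X μ (X ω) ≤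
        ENNReal.ofReal (Real.exp ((q : ℝ) ^ 2 * R ^ 2 / 2)) := by
    refine ae_all_iff.2 fun q => ?_
    obtain ⟨hint, hle⟩ := h q
    have hsm : StronglyMeasurable fun y : ℝ => Real.exp (q * y) :=
      (by fun_prop : Measurable fun y : ℝ => Real.exp (q * y)).stronglyMeasurable
    have h1 := condExp_ae_eq_integral_condDistrib (μ := μ) hX hη.aemeasurable hsm hint
    have hint' : Integrable (fun p : β × ℝ => Real.exp (q * p.2)) (μ.map fun a => (X a, η a)) :=
      (integrable_map_measure (by fun_prop) (by fun_prop)).2 hint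
    have h2 := hint'.condDistrib_ae hX.aemeasurable hη.aemeasurable
    filter_upwards [hle, h1, h2] with ω h3 h4 h5
    rw [← ofReal_integral_eq_lintegral_ofReal h5 (ae_of_all _ fun _ => Real.exp_nonneg _)]
    exact ENNReal.ofReal_le_ofReal (h4 ▸ h3)
  filter_upwards [hrat] with ω hω s
  obtain ⟨q, -, -, hq⟩ := Real.exists_seq_rat_strictMono_tendsto s
  have hlim : ∀ y : ℝ, Filter.Tendsto (fun k => ENNReal.ofReal (Real.exp (q k * y)))
      Filter.atTop (nhds (ENNReal.ofReal (Real.exp (s * y)))) := fun y =>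
    ENNReal.tendsto_ofReal ((Real.continuous_exp.tendsto _).comp (hq.mul_const y))
  calc ∫⁻ y, ENNReal.ofReal (Real.exp (s * y)) ∂condDistrib η X μ (X ω)
      = ∫⁻ y, Filter.liminf (fun k => ENNReal.ofReal (Real.exp (q k * y))) Filter.atTop
          ∂condDistrib η X μ (X ω) := by simp_rw [fun y => (hlim y).liminf_eq]
    _ ≤ Filter.liminf (fun k => ∫⁻ y, ENNReal.ofReal (Real.exp (q k * y))
          ∂condDistrib η X μ (X ω)) Filter.atTop := lintegral_liminf_le fun k => by fun_prop
    _ ≤ Filter.liminf (fun k => ENNReal.ofReal (Real.exp ((q k : ℝ) ^ 2 * R ^ 2 / 2)))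
          Filter.atTop := Filter.liminf_le_liminf (Filter.Eventually.of_forall fun k => hω (q k))
    _ = ENNReal.ofReal (Real.exp (s ^ 2 * R ^ 2 / 2)) := by
      refine Filter.Tendsto.liminf_eq (ENNReal.tendsto_ofReal ?_)
      exact (Real.continuous_exp.tendsto _).comp (((hq.pow 2).mul_const _).div_const 2)

theorem lintegral_mul_mixture_comp_le {β : Type*} {mβ : MeasurableSpace β} {X : Ω → β}
    (hX : Measurable X) {η : Ω → ℝ} (hη : Measurable η) {R : ℝ} (hR : 0 < R)
    (h : IsCondSubGaussian μ (mβ.comap X) η R)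
    {M : β → ℝ≥0∞} (hM : Measurable M) {u w : β → ℝ} (hu : Measurable u)
    (hw : Measurable w) (hw0 : ∀ b, 0 ≤ w b) :
    ∫⁻ ω, M (X ω) * ENNReal.ofReal (Real.exp ((2 * η ω * u (X ω) + η ω ^ 2 * w (X ω)
      - u (X ω) ^ 2) / (2 * R ^ 2 * (1 + w (X ω)))) / √(1 + w (X ω))) ∂μ ≤ ∫⁻ ω, M (X ω) ∂μ := by
  have hcond := ae_forall_lintegral_exp_condDistrib_le hX hη h
  let F : β × ℝ → ℝ≥0∞ := fun p => M p.1 * ENNReal.ofReal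
    (Real.exp ((2 * p.2 * u p.1 + p.2 ^ 2 * w p.1 - u p.1 ^ 2) /
      (2 * R ^ 2 * (1 + w p.1))) / √(1 + w p.1))
  have hF : Measurable F := by fun_prop
  calc ∫⁻ ω, F (X ω, η ω) ∂μ = ∫⁻ p, F p ∂(μ.map fun a => (X a, η a)) :=
        (lintegral_map hF (hX.prodMk hη)).symm
    _ = ∫⁻ b, ∫⁻ y, F (b, y) ∂condDistrib η X μ b ∂(μ.map X) := by
        rw [← compProd_map_condDistrib hη.aemeasurable, Measure.lintegral_compProd hF]
    _ = ∫⁻ ω, ∫⁻ y, F (X ω, y) ∂condDistrib η X μ (X ω) ∂μ :=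
        lintegral_map hF.lintegral_kernel_prod_right' hX
    _ ≤ ∫⁻ ω, M (X ω) ∂μ := by
        refine lintegral_mono_ae ?_
        filter_upwards [hcond] with ω hω
        simp only [F]
        rw [lintegral_const_mul _ (by fun_prop)]
        exact mul_le_of_le_one_right' (lintegral_mixture_le_one hR (hw0 _) _ hω)

end GaussianMixture

/-- The one-step supermartingale inequality of the method of mixtures, where the tilt parameters
`u` and `w` may depend on the past `m`. -/
theorem lintegral_mul_mixture_le {Ω : Type*} {m m₀ : MeasurableSpace Ω}
    {μ : Measure Ω} [IsProbabilityMeasure μ] (hm : m ≤ m₀) {η : Ω → ℝ}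
    (hη : Measurable η) {R : ℝ} (hR : 0 < R) (h : IsCondSubGaussian μ m η R)
    {M : Ω → ENNReal} (hM : Measurable[m] M) {u w : Ω → ℝ} (hu : Measurable[m] u)
    (hw : Measurable[m] w) (hw0 : ∀ ω, 0 ≤ w ω) :
    ∫⁻ ω, M ω * ENNReal.ofReal (Real.exp ((2 * η ω * u ω + η ω ^ 2 * w ω - u ω ^ 2) /
      (2 * R ^ 2 * (1 + w ω))) / √(1 + w ω)) ∂μ ≤ ∫⁻ ω, M ω ∂μ :=
  lintegral_mul_mixture_comp_le (mβ := m) (X := id) (measurable_id'' hm) hη hR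
    (by rwa [MeasurableSpace.comap_id]) hM hu hw hw0

/-! ### Measurability of the regression statistics -/

section Measurability

variable {Ω : Type*} {mΩ : MeasurableSpace Ω}

theorem measurable_det {n : Type*} [Fintype n] [DecidableEq n] {V : Ω → Matrix n n ℝ}
    (hV : ∀ i j, Measurable fun ω => V ω i j) : Measurable fun ω => (V ω).det := by
  simp only [det_apply]
  exact Finset.measurable_sum _ fun σ _ =>
    (Finset.measurable_prod _ fun i _ => hV _ _).const_smul _

theorem measurable_inv_apply {n : Type*} [Fintype n] [DecidableEq n] {V : Ω → Matrix n n ℝ}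
    (hV : ∀ i j, Measurable fun ω => V ω i j) (i j : n) : Measurable fun ω => (V ω)⁻¹ i j := by
  simp only [inv_def, Matrix.smul_apply, adjugate_apply, Ring.inverse_eq_inv', smul_eq_mul]
  refine (measurable_det hV).inv.mul (measurable_det fun k l => ?_)
  by_cases h : k = j
  · subst h; simp
  · simpa [updateRow_ne h] using hV k l

theorem measurable_dotProduct_inv_mulVec {n : Type*} [Fintype n] [DecidableEq n]
    {V : Ω → Matrix n n ℝ} (hV : ∀ i j, Measurable fun ω => V ω i j) {u v : Ω → n → ℝ}
    (hu : ∀ i, Measurable fun ω => u ω i) (hv : ∀ i, Measurable fun ω => v ω i) :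
    Measurable fun ω => u ω ⬝ᵥ (V ω)⁻¹ *ᵥ v ω := by
  simp only [dotProduct, mulVec]
  exact Finset.measurable_sum _ fun i _ => (hu i).mul <|
    Finset.measurable_sum _ fun j _ => (measurable_inv_apply hV i j).mul (hv j)

variable {d : ℕ} {X : ℕ → Ω → EuclideanSpace ℝ (Fin d)} {n : ℕ}

theorem measurable_apply {x : Ω → EuclideanSpace ℝ (Fin d)} (hx : Measurable x) (i : Fin d) :
    Measurable fun ω => x ω i :=
  (EuclideanSpace.proj (𝕜 := ℝ) i).continuous.measurable.comp hx

theorem measurable_designMatrix_apply (lam : ℝ) (hX : ∀ s, 1 ≤ s → s ≤ n → Measurable (X s))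
    (i j : Fin d) : Measurable fun ω => designMatrix lam (fun s => X s ω) n i j := by
  induction n with
  | zero => exact measurable_const
  | succ n ih =>
    have hx := hX (n + 1) (by omega) le_rfl
    exact (ih fun s h1 h2 => hX s h1 (by omega)).add
      ((measurable_apply hx i).mul (measurable_apply hx j))

theorem measurable_responseVector {η : ℕ → Ω → ℝ} (hX : ∀ s, 1 ≤ s → s ≤ n → Measurable (X s))
    (hη : ∀ s, 1 ≤ s → s ≤ n → Measurable (η s)) :
    Measurable fun ω => responseVector (fun s => X s ω) (fun s => η s ω) n := by
  induction n with
  | zero => exact measurable_const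
  | succ n ih =>
    exact (ih (fun s h1 h2 => hX s h1 (by omega)) fun s h1 h2 => hη s h1 (by omega)).add
      ((hη (n + 1) (by omega) le_rfl).smul (hX (n + 1) (by omega) le_rfl))

theorem measurable_sqInvNorm_responseVector (lam : ℝ) {η : ℕ → Ω → ℝ}
    (hX : ∀ s, 1 ≤ s → s ≤ n → Measurable (X s)) (hη : ∀ s, 1 ≤ s → s ≤ n → Measurable (η s)) :
    Measurable fun ω => sqInvNorm (designMatrix lam (fun s => X s ω) n)
      (responseVector (fun s => X s ω) (fun s => η s ω) n) :=
  have h := measurable_apply (measurable_responseVector hX hη)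
  measurable_dotProduct_inv_mulVec (measurable_designMatrix_apply lam hX) h h

end Measurability

section History

variable {Ω : Type u} {ι : Type v} [MeasurableSpace ι] {A : ℕ → Ω → ι} {Y : ℕ → Ω → ℝ}

theorem measurable_arm_history {s t : ℕ} (h1 : 1 ≤ s) (h2 : s ≤ t) :
    Measurable[history A Y t] (A s) :=
  measurable_iff_comap_le.2 <| le_sup_of_le_left <|
    le_iSup₂_of_le s (Finset.mem_Icc.2 ⟨h1, h2⟩) le_rfl

theorem measurable_reward_history {s t : ℕ} (h1 : 1 ≤ s) (h2 : s < t) :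
    Measurable[history A Y t] (Y s) :=
  measurable_iff_comap_le.2 <| le_sup_of_le_right <|
    le_iSup₂_of_le s (Finset.mem_Ico.2 ⟨h1, h2⟩) le_rfl

end History

/-! ### The self-normalized tail bound -/

section SelfNormalized

/-- A conditionally `0`-sub-Gaussian variable vanishes: `E[e^η + e^{-η} - 2] ≤ 0`, and the integrand
is positive unless `η = 0`. -/
theorem ae_eq_zero_of_isCondSubGaussian_zero {Ω : Type*} {m m₀ : MeasurableSpace Ω} {μ : Measure Ω}
    [IsProbabilityMeasure μ] (hm : m ≤ m₀) {η : Ω → ℝ} (h : IsCondSubGaussian μ m η 0) :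
    ∀ᵐ ω ∂μ, η ω = 0 := by
  have hle : ∀ s : ℝ, ∫ ω, Real.exp (s * η ω) ∂μ ≤ 1 := by
    intro s
    rw [← integral_condExp hm]
    refine (integral_mono_ae integrable_condExp (integrable_const _) (h s).2).trans ?_
    simp
  have hpt : ∀ y : ℝ, 0 ≤ Real.exp (1 * y) + Real.exp (-1 * y) - 2 := fun y => by
    nlinarith [Real.add_one_le_exp (1 * y), Real.add_one_le_exp (-1 * y)]
  have hint := ((h 1).1.add (h (-1)).1).sub (integrable_const (2 : ℝ))
  have h0 : ∫ ω, (Real.exp (1 * η ω) + Real.exp (-1 * η ω) - 2) ∂μ = 0 := by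
    refine le_antisymm ?_ (integral_nonneg fun ω => hpt _)
    have hs := integral_sub ((h 1).1.add (h (-1)).1) (integrable_const (2 : ℝ))
    have ha := integral_add (h 1).1 (h (-1)).1
    simp only [Pi.add_apply] at hs ha
    rw [hs, ha]
    have h1 := hle 1
    have h2 := hle (-1)
    simp only [integral_const, probReal_univ, one_smul]
    linarith
  have h1 := (integral_eq_zero_iff_of_nonneg (fun ω => hpt _) hint).1 h0
  filter_upwards [h1] with ω hω
  by_contra hne
  simp only [Pi.zero_apply, one_mul] at hω
  have h2 := Real.add_one_lt_exp hne
  have h3 := Real.add_one_le_exp (-1 * η ω)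
  linarith

theorem responseVector_eq_zero {d : ℕ} {X : ℕ → EuclideanSpace ℝ (Fin d)} {η : ℕ → ℝ} {n : ℕ}
    (h : ∀ t, 1 ≤ t → η t = 0) : responseVector X η n = 0 := by
  induction n with
  | zero => rfl
  | succ n ih => simp [responseVector, ih, h (n + 1) (by omega)]

/-- The mixture likelihood ratio of the first `n` noise variables: the exponential of the squared
dual norm of the noise vector, normalized by the square root of a determinant. -/
noncomputable def mixtureProcess {d : ℕ} (lam R : ℝ) (X : ℕ → EuclideanSpace ℝ (Fin d))
    (η : ℕ → ℝ) (n : ℕ) : ℝ :=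
  Real.exp (sqInvNorm (designMatrix lam X n) (responseVector X η n) / (2 * R ^ 2)) *
    √(lam ^ d / (designMatrix lam X n).det)

/-- The next ratio is a Gaussian mixture of exponentials of the new noise variable, whose
parameters are determined by the past. -/
theorem mixtureProcess_succ {d : ℕ} {lam : ℝ} (hlam : 0 < lam) (R : ℝ)
    (X : ℕ → EuclideanSpace ℝ (Fin d)) (η : ℕ → ℝ) (n : ℕ) :
    mixtureProcess lam R X η (n + 1) = mixtureProcess lam R X η n *
      (Real.exp ((2 * η (n + 1) * ((X (n + 1)).ofLp ⬝ᵥ (designMatrix lam X n)⁻¹ *ᵥ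
          (responseVector X η n).ofLp)
        + η (n + 1) ^ 2 * sqInvNorm (designMatrix lam X n) (X (n + 1))
        - ((X (n + 1)).ofLp ⬝ᵥ (designMatrix lam X n)⁻¹ *ᵥ (responseVector X η n).ofLp) ^ 2) /
          (2 * R ^ 2 * (1 + sqInvNorm (designMatrix lam X n) (X (n + 1))))) /
        √(1 + sqInvNorm (designMatrix lam X n) (X (n + 1)))) := by
  have hV := designMatrix_posDef hlam X n
  have hw := sqInvNorm_nonneg hV (X (n + 1))
  have hdet := hV.det_pos
  have hsm : sqInvNorm (designMatrix lam X (n + 1)) (responseVector X η (n + 1)) = _ :=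
    add_smul_inv_add_vecMulVec hV (X (n + 1)).ofLp (responseVector X η n).ofLp (η (n + 1))
  rw [mixtureProcess, mixtureProcess, hsm, det_designMatrix_succ hlam, ← div_div (lam ^ d),
    Real.sqrt_div (by positivity) (1 + _), add_div _ _ (2 * R ^ 2), Real.exp_add]
  simp only [sqInvNorm]
  rw [div_div _ (1 + _) (2 * R ^ 2), mul_comm (1 + _) (2 * R ^ 2)]
  ring

variable {Ω : Type u} [MeasurableSpace Ω] {μ : Measure Ω} [IsProbabilityMeasure μ]
  {ι : Type v} [MeasurableSpace ι] {d : ℕ} {θ : EuclideanSpace ℝ (Fin d)}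
  {x : ℕ → ι → EuclideanSpace ℝ (Fin d)} {A : ℕ → Ω → ι} {Y : ℕ → Ω → ℝ} {lam R L : ℝ}

theorem history_le (hA : ∀ t, Measurable (A t)) (hY : ∀ t, Measurable (Y t)) (t : ℕ) :
    history A Y t ≤ ‹MeasurableSpace Ω› :=
  sup_le (iSup₂_le fun s _ => (hA s).comap_le) (iSup₂_le fun s _ => (hY s).comap_le)

theorem lintegral_mixtureProcess_le_one (hlam : 0 < lam) (hR : 0 < R)
    (hx : ∀ t, Measurable (x t)) (hA : ∀ t, Measurable (A t)) (hY : ∀ t, Measurable (Y t))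
    (hsub : ∀ t, 1 ≤ t → IsCondSubGaussian μ (history A Y t)
      (fun ω => Y t ω - inner ℝ θ (x t (A t ω))) R) (n : ℕ) :
    ∫⁻ ω, ENNReal.ofReal (mixtureProcess lam R (fun s => x s (A s ω))
      (fun s => Y s ω - inner ℝ θ (x s (A s ω))) n) ∂μ ≤ 1 := by
  induction n with
  | zero =>
    simp [mixtureProcess, responseVector, designMatrix, sqInvNorm, hlam.ne']
  | succ n ih =>
    refine le_trans ?_ ih
    have hXm : ∀ s, 1 ≤ s → s ≤ n + 1 →
        Measurable[history A Y (n + 1)] fun ω => x s (A s ω) := fun s h1 h2 =>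
      (hx s).comp (measurable_arm_history h1 h2)
    have hXn := fun s h1 (h2 : s ≤ n) => hXm s h1 (by omega)
    have hηm : ∀ s, 1 ≤ s → s ≤ n →
        Measurable[history A Y (n + 1)] fun ω => Y s ω - inner ℝ θ (x s (A s ω)) :=
      fun s h1 h2 => (measurable_reward_history h1 (by omega)).sub
        (Measurable.comp (g := fun v => inner ℝ θ v) (by fun_prop) (hXn s h1 h2))
    have hη : Measurable fun ω => Y (n + 1) ω - inner ℝ θ (x (n + 1) (A (n + 1) ω)) :=
      (hY _).sub (Measurable.comp (g := fun v => inner ℝ θ v) (by fun_prop)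
        ((hx (n + 1)).comp (hA (n + 1))))
    have hV := measurable_designMatrix_apply (mΩ := history A Y (n + 1)) lam hXn
    have hx' := measurable_apply (mΩ := history A Y (n + 1)) (hXm (n + 1) (by omega) le_rfl)
    have hN := measurable_apply (mΩ := history A Y (n + 1)) (measurable_responseVector hXn hηm)
    have hq := measurable_sqInvNorm_responseVector (mΩ := history A Y (n + 1)) lam hXn hηm
    have hM : Measurable[history A Y (n + 1)] fun ω => ENNReal.ofReal (mixtureProcess lam R
        (fun s => x s (A s ω)) (fun s => Y s ω - inner ℝ θ (x s (A s ω))) n) :=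
      ENNReal.measurable_ofReal.comp <| (Real.measurable_exp.comp (hq.div_const _)).mul
        (measurable_const.div (measurable_det hV)).sqrt
    have key := lintegral_mul_mixture_le (history_le hA hY (n + 1)) hη hR (hsub (n + 1) (by omega))
      hM (measurable_dotProduct_inv_mulVec hV hx' hN)
      (measurable_dotProduct_inv_mulVec hV hx' hx')
      (fun ω => sqInvNorm_nonneg (designMatrix_posDef hlam _ n) _)
    refine le_trans (le_of_eq (lintegral_congr fun ω => ?_)) key
    rw [mixtureProcess_succ hlam, ENNReal.ofReal_mul (by unfold mixtureProcess; positivity)]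
    rfl

/-- The self-normalized tail bound for the noise vector of the rounds before `t`.  The factor
`d ≥ 1` in front of `log t²` allows the failure probability `1 / t`. -/
theorem measure_noise_gt_le (hlam : 0 < lam) (hR : 0 ≤ R) (hd : 1 ≤ d)
    (hx : ∀ t, Measurable (x t)) (hA : ∀ t, Measurable (A t)) (hY : ∀ t, Measurable (Y t))
    (hsub : ∀ t, 1 ≤ t → IsCondSubGaussian μ (history A Y t)
      (fun ω => Y t ω - inner ℝ θ (x t (A t ω))) R)
    (hL : ∀ t, 1 ≤ t → ∀ᵐ ω ∂μ, ‖x t (A t ω)‖ ≤ L) {t : ℕ} (ht : 1 ≤ t) :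
    μ {ω | R * √(d * Real.log ((1 + (t - 1 : ℕ) * L ^ 2 / lam) / (1 / (t : ℝ) ^ 2))) <
      √(sqInvNorm (designMatrix lam (fun s => x s (A s ω)) (t - 1))
        (responseVector (fun s => x s (A s ω))
          (fun s => Y s ω - inner ℝ θ (x s (A s ω))) (t - 1)))} ≤ ENNReal.ofReal (1 / t) := by
  have ht0 : (0 : ℝ) < t := by exact_mod_cast ht
  have ht1 : (1 : ℝ) ≤ t := by exact_mod_cast ht
  rcases hR.eq_or_lt with rfl | hR
  -- `R = 0`: the mixture process divides by `R`, but the noise vanishes almost surely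
  · refine le_trans (le_of_eq ?_) zero_le
    rw [← compl_mem_ae_iff]
    have h0 : ∀ᵐ ω ∂μ, ∀ s, 1 ≤ s → Y s ω - inner ℝ θ (x s (A s ω)) = 0 :=
      ae_all_iff.2 fun s => Filter.eventually_imp_distrib_left.2 fun hs =>
        ae_eq_zero_of_isCondSubGaussian_zero (history_le hA hY s) (hsub s hs)
    filter_upwards [h0] with ω hω
    simp [responseVector_eq_zero hω, sqInvNorm]
  set M : Ω → ℝ := fun ω => mixtureProcess lam R (fun s => x s (A s ω))
    (fun s => Y s ω - inner ℝ θ (x s (A s ω))) (t - 1) with hM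
  have hbound : ∀ᵐ ω ∂μ, ∀ s, 1 ≤ s → ‖x s (A s ω)‖ ≤ L :=
    ae_all_iff.2 fun s => Filter.eventually_imp_distrib_left.2 fun hs => hL s hs
  have hMm : AEMeasurable (fun ω => ENNReal.ofReal (M ω)) μ := by
    have hXn : ∀ s, 1 ≤ s → s ≤ t - 1 → Measurable fun ω => x s (A s ω) :=
      fun s _ _ => (hx s).comp (hA s)
    have hη : ∀ s, 1 ≤ s → s ≤ t - 1 → Measurable fun ω => Y s ω - inner ℝ θ (x s (A s ω)) :=
      fun s h1 h2 => (hY _).sub (Measurable.comp (g := fun v => inner ℝ θ v) (by fun_prop)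
        (hXn s h1 h2))
    have hq := measurable_sqInvNorm_responseVector lam hXn hη
    have hV := measurable_det (measurable_designMatrix_apply lam hXn)
    exact (ENNReal.measurable_ofReal.comp <| (Real.measurable_exp.comp (hq.div_const _)).mul
      (measurable_const.div hV).sqrt).aemeasurable
  have hmarkov : μ {ω | ENNReal.ofReal t ≤ ENNReal.ofReal (M ω)} ≤ ENNReal.ofReal (1 / t) := by
    have h1 := (mul_meas_ge_le_lintegral₀ hMm (ENNReal.ofReal t)).trans
      (lintegral_mixtureProcess_le_one hlam hR hx hA hY hsub (t - 1))
    rw [one_div, ENNReal.ofReal_inv_of_pos ht0, ENNReal.le_inv_iff_mul_le, mul_comm]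
    exact h1
  refine (measure_mono_ae ?_).trans hmarkov
  filter_upwards [hbound] with ω hω hlt
  change _ < _ at hlt
  change ENNReal.ofReal t ≤ ENNReal.ofReal (M ω)
  apply ENNReal.ofReal_le_ofReal
  set V := designMatrix lam (fun s => x s (A s ω)) (t - 1) with hV
  set q := sqInvNorm V (responseVector (fun s => x s (A s ω))
    (fun s => Y s ω - inner ℝ θ (x s (A s ω))) (t - 1)) with hq
  have hVpd : V.PosDef := designMatrix_posDef hlam _ _
  have hq0 : 0 ≤ q := sqInvNorm_nonneg hVpd _
  have hdet : Real.log (V.det / lam ^ d) ≤ d * Real.log (1 + (t - 1 : ℕ) * L ^ 2 / lam) :=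
    log_det_designMatrix_le hlam fun s hs => hω s (Finset.mem_Icc.1 hs).1
  have hnn : 0 ≤ ((t - 1 : ℕ) : ℝ) * L ^ 2 / lam := by positivity
  have hd1 : (1 : ℝ) ≤ d := by exact_mod_cast hd
  have hlogt := Real.log_nonneg ht1
  have hqlow : R ^ 2 * (2 * Real.log t + Real.log (V.det / lam ^ d)) ≤ q := by
    have h1 : R ^ 2 * (d * Real.log ((1 + (t - 1 : ℕ) * L ^ 2 / lam) / (1 / (t : ℝ) ^ 2))) ≤ q := by
      have hlog : 0 ≤ d * Real.log ((1 + (t - 1 : ℕ) * L ^ 2 / lam) / (1 / (t : ℝ) ^ 2)) := by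
        rw [div_div_eq_mul_div, div_one]
        exact mul_nonneg (by positivity) (Real.log_nonneg (by nlinarith))
      rw [← Real.sq_sqrt hlog, ← mul_pow, ← Real.sq_sqrt hq0]
      gcongr
    refine le_trans ?_ h1
    rw [div_div_eq_mul_div, div_one, Real.log_mul (by positivity) (by positivity), Real.log_pow]
    gcongr
    push_cast
    nlinarith
  have hdpos : 0 < V.det / lam ^ d := div_pos hVpd.det_pos (by positivity)
  have hsq : √(lam ^ d / V.det) = Real.exp (-(Real.log (V.det / lam ^ d) / 2)) := by
    rw [← inv_div, Real.sqrt_inv, Real.exp_neg, Real.exp_half, Real.exp_log hdpos]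
  change (t : ℝ) ≤ Real.exp (q / (2 * R ^ 2)) * √(lam ^ d / V.det)
  rw [hsq, ← Real.exp_add]
  nth_rewrite 1 [← Real.exp_log ht0]
  gcongr
  have : Real.log t + Real.log (V.det / lam ^ d) / 2 ≤ q / (2 * R ^ 2) := by
    rw [le_div_iff₀ (by positivity)]
    linarith
  linarith

end SelfNormalized

/-! ### The regret of one realization -/

section Deterministic

variable {d : ℕ} {lam R S L : ℝ}

theorem one_le_confWidth (hR : 0 ≤ R) (hlamS : 1 ≤ √lam * S) (n : ℕ) (γ : ℝ) :
    1 ≤ confWidth d lam R S L n γ := by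
  rw [confWidth]
  refine one_le_pow₀ (hlamS.trans ?_)
  exact le_add_of_nonneg_left (by positivity)

theorem lam_mul_sq_le_confWidth (hlam : 0 < lam) (hR : 0 ≤ R) (hS : 0 < S) (n : ℕ) (γ : ℝ) :
    lam * S ^ 2 ≤ confWidth d lam R S L n γ := by
  rw [confWidth]
  nth_rewrite 1 [← Real.sq_sqrt hlam.le]
  rw [← mul_pow]
  gcongr
  exact le_add_of_nonneg_left (by positivity)

variable {ι : Type v} {θ : EuclideanSpace ℝ (Fin d)} {𝒜 : ℕ → Set ι}
  {x : ℕ → ι → EuclideanSpace ℝ (Fin d)} {A : ℕ → ι} {Y : ℕ → ℝ}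

theorem gap_nonneg {𝒜 : Set ι} {x : ι → EuclideanSpace ℝ (Fin d)} {a : ι}
    (hbdd : BddAbove ((fun a => inner ℝ θ (x a)) '' 𝒜)) (ha : a ∈ 𝒜) : 0 ≤ gap θ 𝒜 x a :=
  sub_nonneg.2 (le_csSup hbdd ⟨a, ha, rfl⟩)

/-- The gap in round `t` of a run of LinIMED-1 on which the noise vector is within its confidence
bound. -/
theorem sq_gap_le_of_isRun (hlam : 0 < lam) (hR : 0 ≤ R) (hS : 0 < S) (hlamS : 1 ≤ √lam * S)
    (hrun : IsRun lam R S L 𝒜 x A Y) (hL : ∀ t, 1 ≤ t → ‖x t (A t)‖ ≤ L) (hθ : ‖θ‖ ≤ S)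
    {t : ℕ} (ht : 1 ≤ t) (hbdd : BddAbove ((fun a => inner ℝ θ (x t a)) '' 𝒜 t))
    (hnonneg : ∀ a ∈ 𝒜 t, 0 ≤ inner ℝ θ (x t a))
    (hgood : √(sqInvNorm (designMatrix lam (fun s => x s (A s)) (t - 1))
        (responseVector (fun s => x s (A s)) (fun s => Y s - inner ℝ θ (x s (A s))) (t - 1))) ≤
      R * √(d * Real.log ((1 + (t - 1 : ℕ) * L ^ 2 / lam) / (1 / (t : ℝ) ^ 2)))) :
    gap θ (𝒜 t) (x t) (A t) ^ 2 ≤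
      (64 * Real.exp 16 + 256 + 16 * Real.log (1 + (t - 1 : ℕ) * L ^ 2 / lam)) *
        (confWidth d lam R S L (t - 1) (1 / (t : ℝ) ^ 2) *
          sqInvNorm (designMatrix lam (fun s => x s (A s)) (t - 1)) (x t (A t))) := by
  set X := fun s => x s (A s) with hX
  have hV := designMatrix_posDef hlam X (t - 1)
  have hβ := one_le_confWidth (d := d) (L := L) hR hlamS (t - 1) (1 / (t : ℝ) ^ 2)
  have hκ0 : 0 ≤ ((t - 1 : ℕ) : ℝ) * L ^ 2 / lam := by positivity
  refine sq_gap_le_of_isMinIndexArm hV (by linarith) (by linarith) (fun j _ => ?_) (fun j => ?_)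
    (hrun t ht) hbdd hnonneg
  · refine (abs_inner_ridgeEstimate_sub_le hlam X Y θ hθ (t - 1) (x t j)).trans ?_
    rw [Real.sqrt_mul (by linarith), confWidth, Real.sqrt_sq (by positivity)]
    gcongr
  · have hw := sqInvNorm_nonneg hV (x t j)
    have h1 := dotProduct_self_le_mul_inv hV (c := lam + (t - 1 : ℕ) * L ^ 2) (by positivity)
      (designMatrix_le_mul_norm_sq (fun s hs => hL s (Finset.mem_Icc.1 hs).1) (x t j).ofLp)
    rw [dotProduct_ofLp, real_inner_self_eq_norm_sq] at h1
    change _ ≤ _ * sqInvNorm _ (x t j) at h1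
    calc (inner ℝ θ (x t j)) ^ 2 ≤ (‖θ‖ * ‖x t j‖) ^ 2 :=
          sq_le_sq' (by linarith [neg_abs_le (inner ℝ θ (x t j)), abs_real_inner_le_norm θ (x t j)])
            (real_inner_le_norm _ _)
      _ = ‖θ‖ ^ 2 * ‖x t j‖ ^ 2 := mul_pow _ _ _
      _ ≤ S ^ 2 * ((lam + (t - 1 : ℕ) * L ^ 2) * sqInvNorm (designMatrix lam X (t - 1)) (x t j)) := by
          gcongr
      _ = (1 + (t - 1 : ℕ) * L ^ 2 / lam) *
            (lam * S ^ 2 * sqInvNorm (designMatrix lam X (t - 1)) (x t j)) := by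
          field_simp
      _ ≤ _ := by
          gcongr
          exact lam_mul_sq_le_confWidth hlam hR hS _ _

/-- The regret of one realization: every round outside the confidence event (the rounds in `bad`)
costs at most one, and the other rounds are summed by Cauchy–Schwarz and the elliptical potential
lemma.  The number `B` bounds the squared gap per unit of squared dual norm. -/
theorem pathRegret_le (hlam : 0 < lam) {bad : Set ℕ} {T : ℕ} {B : ℝ} (hB : 1 ≤ B)
    (hL : ∀ t, 1 ≤ t → ‖x t (A t)‖ ≤ L)
    (hgap1 : ∀ t, 1 ≤ t → gap θ (𝒜 t) (x t) (A t) ≤ 1)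
    (hgap : ∀ t ∈ Finset.Icc 1 T, t ∉ bad → gap θ (𝒜 t) (x t) (A t) ^ 2 ≤
      B * sqInvNorm (designMatrix lam (fun s => x s (A s)) (t - 1)) (x t (A t)))
    (hgap0 : ∀ t, 1 ≤ t → 0 ≤ gap θ (𝒜 t) (x t) (A t)) :
    pathRegret θ 𝒜 x A T ≤ ∑ t ∈ Finset.Icc 1 T, bad.indicator 1 t +
      √(T * (B * (2 * (d * Real.log (1 + T * L ^ 2 / lam))))) := by
  set X := fun s => x s (A s) with hX
  set v : ℕ → ℝ := fun t => min 1 (sqInvNorm (designMatrix lam X (t - 1)) (X t)) with hv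
  have hv0 : ∀ t, 0 ≤ v t := fun t =>
    le_min zero_le_one (sqInvNorm_nonneg (designMatrix_posDef hlam X _) _)
  have hround : ∀ t ∈ Finset.Icc 1 T,
      gap θ (𝒜 t) (x t) (A t) ≤ bad.indicator 1 t + √(B * v t) := by
    intro t ht
    have ht1 := (Finset.mem_Icc.1 ht).1
    have h1 := hgap1 t ht1
    by_cases hb : t ∈ bad
    · rw [Set.indicator_of_mem hb, Pi.one_apply]
      linarith [Real.sqrt_nonneg (B * v t)]
    · rw [Set.indicator_of_notMem hb, zero_add]
      refine Real.le_sqrt_of_sq_le ?_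
      rw [hv, mul_min_of_nonneg _ _ (by linarith)]
      refine le_min ?_ (hgap t ht hb)
      rw [mul_one]
      exact (pow_le_one₀ (hgap0 t ht1) h1).trans hB
  have hpot : ∑ t ∈ Finset.Icc 1 T, v t ≤ 2 * (d * Real.log (1 + T * L ^ 2 / lam)) := by
    refine (sum_min_one_sqInvNorm_le hlam X T).trans ?_
    have := log_det_designMatrix_le hlam (X := X) (t := T) fun s hs => hL s (Finset.mem_Icc.1 hs).1
    linarith
  refine (Finset.sum_le_sum hround).trans ?_
  rw [Finset.sum_add_distrib]
  gcongr
  refine Real.le_sqrt_of_sq_le ((sq_sum_le_card_mul_sum_sq).trans ?_)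
  simp_rw [fun t => Real.sq_sqrt (mul_nonneg (by linarith : 0 ≤ B) (hv0 t))]
  rw [← Finset.mul_sum, Nat.card_Icc, Nat.add_sub_cancel]
  gcongr

end Deterministic

/-! ### Logarithmic estimates of the constants -/

section Constants

variable {lam R S L : ℝ} {T : ℕ}

theorem half_le_log {T : ℕ} (hT : 2 ≤ T) : 1 / 2 ≤ Real.log T := by
  have h1 : Real.log 2 ≤ Real.log T := Real.log_le_log (by norm_num) (by exact_mod_cast hT)
  linarith [Real.log_two_gt_d9]

theorem log_one_add_mul_le {r : ℝ} (hr : 0 ≤ r) (hT : 2 ≤ T) :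
    Real.log (1 + T * r) ≤ (1 + 2 * Real.log (1 + r)) * Real.log T := by
  have hT' : (2 : ℝ) ≤ T := by exact_mod_cast hT
  have h0 := Real.log_nonneg (by linarith : 1 ≤ 1 + r)
  have h1 : Real.log (1 + T * r) ≤ Real.log ((1 + r) * T) :=
    Real.log_le_log (by positivity) (by nlinarith)
  rw [Real.log_mul (by positivity) (by positivity)] at h1
  nlinarith [half_le_log hT]

theorem log_one_add_natCast_mul_mono {r : ℝ} (hr : 0 ≤ r) {n : ℕ} (hn : n ≤ T) :
    Real.log (1 + n * r) ≤ Real.log (1 + T * r) := by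
  have : (n : ℝ) ≤ T := by exact_mod_cast hn
  exact Real.log_le_log (by positivity) (by gcongr)

theorem confWidth_le {d : ℕ} (hlam : 0 < lam) (hd : 1 ≤ d) (hT : 2 ≤ T) {t : ℕ} (ht : 1 ≤ t)
    (htT : t ≤ T) :
    confWidth d lam R S L (t - 1) (1 / (t : ℝ) ^ 2) ≤
      (2 * R ^ 2 * (3 + 2 * Real.log (1 + L ^ 2 / lam)) + 4 * (lam * S ^ 2)) *
        (d * Real.log T) := by
  have hr : 0 ≤ L ^ 2 / lam := by positivity
  have hd1 : (1 : ℝ) ≤ d := by exact_mod_cast hd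
  have ht1 : (1 : ℝ) ≤ t := by exact_mod_cast ht
  have hl := half_le_log hT
  have hlog : Real.log ((1 + (t - 1 : ℕ) * L ^ 2 / lam) / (1 / (t : ℝ) ^ 2)) ≤
      (3 + 2 * Real.log (1 + L ^ 2 / lam)) * Real.log T := by
    have h1 := log_one_add_natCast_mul_mono hr (show t - 1 ≤ T by omega)
    have h2 := log_one_add_mul_le hr hT
    have h3 : Real.log t ≤ Real.log T :=
      Real.log_le_log (by positivity) (by exact_mod_cast htT)
    rw [div_div_eq_mul_div, div_one, mul_div_assoc, Real.log_mul (by positivity) (by positivity),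
      Real.log_pow]
    push_cast
    linarith
  have hlog0 : 0 ≤ Real.log ((1 + (t - 1 : ℕ) * L ^ 2 / lam) / (1 / (t : ℝ) ^ 2)) := by
    rw [div_div_eq_mul_div, div_one, mul_div_assoc]
    refine Real.log_nonneg ?_
    have : 0 ≤ ((t - 1 : ℕ) : ℝ) * (L ^ 2 / lam) := by positivity
    nlinarith
  rw [confWidth]
  refine (add_sq_le).trans ?_
  rw [mul_pow, mul_pow, Real.sq_sqrt (by positivity), Real.sq_sqrt hlam.le]
  have h4 : R ^ 2 * (d * Real.log ((1 + (t - 1 : ℕ) * L ^ 2 / lam) / (1 / (t : ℝ) ^ 2))) ≤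
      R ^ 2 * (d * ((3 + 2 * Real.log (1 + L ^ 2 / lam)) * Real.log T)) := by
    gcongr
  have h5 : lam * S ^ 2 ≤ lam * S ^ 2 * (2 * (d * Real.log T)) := by
    refine le_mul_of_one_le_right (by positivity) ?_
    nlinarith
  linarith

theorem sum_inv_le_one_add_log (T : ℕ) :
    ∑ t ∈ Finset.Icc 1 T, 1 / (t : ℝ) ≤ 1 + Real.log T := by
  refine le_trans (le_of_eq ?_) (harmonic_le_one_add_log T)
  rw [harmonic_eq_sum_Icc]
  push_cast
  simp

theorem one_add_log_le {d : ℕ} (hd : 1 ≤ d) (hT : 2 ≤ T) :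
    1 + Real.log T ≤ 6 * (d * √T * Real.log T ^ (3 / 2 : ℝ)) := by
  have hl := half_le_log hT
  have hd1 : (1 : ℝ) ≤ d := by exact_mod_cast hd
  have hT1 : 1 ≤ √(T : ℝ) := Real.one_le_sqrt.2 (by exact_mod_cast (by omega : 1 ≤ T))
  have hpow : Real.log T ^ (3 / 2 : ℝ) = Real.log T * √(Real.log T) := by
    rw [show (3 / 2 : ℝ) = 1 + 1 / 2 by norm_num, Real.rpow_add (by linarith), Real.rpow_one,
      Real.sqrt_eq_rpow]
  have hsq : 1 / 2 ≤ √(Real.log T) := Real.le_sqrt_of_sq_le (by linarith)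
  have h1 : Real.log T * (1 / 2) ≤ Real.log T ^ (3 / 2 : ℝ) := by
    rw [hpow]; gcongr
  have h2 : Real.log T ^ (3 / 2 : ℝ) ≤ d * √T * Real.log T ^ (3 / 2 : ℝ) :=
    le_mul_of_one_le_left (by positivity) (one_le_mul_of_one_le_of_one_le hd1 hT1)
  linarith

theorem sqrt_mul_sq_mul_log_pow {c : ℝ} (hc : 0 ≤ c) (d : ℕ) (T : ℕ) :
    √(c * (T * d ^ 2 * Real.log T ^ 3)) = √c * (d * √T * Real.log T ^ (3 / 2 : ℝ)) := by
  have hl : 0 ≤ Real.log T := Real.log_natCast_nonneg T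
  have hpow : (Real.log T ^ (3 / 2 : ℝ)) ^ 2 = Real.log T ^ 3 := by
    rw [← Real.rpow_natCast, ← Real.rpow_mul hl, ← Real.rpow_natCast]
    norm_num
  rw [Real.sqrt_mul hc, ← hpow, Real.sqrt_mul (by positivity), Real.sqrt_mul (by positivity),
    Real.sqrt_sq (by positivity), Real.sqrt_sq (by positivity)]
  ring

end Constants

theorem pathRegret_eq_zero {ι : Type v} (θ : EuclideanSpace ℝ (Fin 0)) (𝒜 : ℕ → Set ι)
    (x : ℕ → ι → EuclideanSpace ℝ (Fin 0)) (A : ℕ → ι) (T : ℕ) : pathRegret θ 𝒜 x A T = 0 := by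
  refine Finset.sum_eq_zero fun t _ => ?_
  have h : ∀ y : EuclideanSpace ℝ (Fin 0), inner ℝ θ y = 0 := fun y => by
    rw [Subsingleton.elim y 0, inner_zero_right]
  simp only [gap, h, sub_zero]
  rcases (𝒜 t).eq_empty_or_nonempty with h0 | h0
  · simp [h0]
  · simp [h0.image_const]

end LinIMED

/-! ### The regret bound -/

theorem theorem1 (lam R S L : ℝ) (hlam : 0 < lam) (hR : 0 ≤ R) (hS : 0 < S) (hL : 0 < L)
    (hlamS : 1 ≤ Real.sqrt lam * S) :
    ∃ C : ℝ, ∀ (d : ℕ) (Ω : Type u) [MeasurableSpace Ω] (μ : MeasureTheory.Measure Ω)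
      [MeasureTheory.IsProbabilityMeasure μ] (ι : Type v) [MeasurableSpace ι]
      (θ : EuclideanSpace ℝ (Fin d)) (𝒜 : ℕ → Set ι) (x : ℕ → ι → EuclideanSpace ℝ (Fin d))
      (A : ℕ → Ω → ι) (Y : ℕ → Ω → ℝ),
      (∀ t, Measurable (x t)) → (∀ t, Measurable (A t)) → (∀ t, Measurable (Y t)) →
      -- the noise `Y t - ⟨θ, X t⟩` is conditionally sub-Gaussian
      (∀ t, 1 ≤ t → LinIMED.IsCondSubGaussian μ (LinIMED.history A Y t)
        (fun ω => Y t ω - inner ℝ θ (x t (A t ω))) R) →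
      -- the arms are pulled by LinIMED-1
      (∀ᵐ ω ∂μ, LinIMED.IsRun lam R S L 𝒜 x (fun t => A t ω) (fun t => Y t ω)) →
      -- the contexts of the pulled arms, the parameter and the gaps are bounded
      (∀ t, 1 ≤ t → ∀ᵐ ω ∂μ, ‖x t (A t ω)‖ ≤ L) →
      ‖θ‖ ≤ S →
      (∀ t, 1 ≤ t → BddAbove ((fun a => inner ℝ θ (x t a)) '' 𝒜 t)) →
      (∀ t, 1 ≤ t → ∀ b ∈ 𝒜 t, LinIMED.gap θ (𝒜 t) (x t) b ≤ 1) →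
      -- the mean rewards are nonnegative
      (∀ t, 1 ≤ t → ∀ a ∈ 𝒜 t, 0 ≤ inner ℝ θ (x t a)) →
      ∀ T : ℕ, 2 ≤ T →
        MeasureTheory.Integrable (fun ω => LinIMED.pathRegret θ 𝒜 x (fun t => A t ω) T) μ ∧
        ∫ ω, LinIMED.pathRegret θ 𝒜 x (fun t => A t ω) T ∂μ ≤
          C * (d * Real.sqrt T * Real.log T ^ (3 / 2 : ℝ)) := by
  open LinIMED MeasureTheory in
  set c₁ : ℝ := 1 + 2 * Real.log (1 + L ^ 2 / lam) with hc₁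
  set c₂ : ℝ := 2 * (64 * Real.exp 16 + 256) + 16 * c₁ with hc₂
  set c₃ : ℝ := 2 * R ^ 2 * (3 + 2 * Real.log (1 + L ^ 2 / lam)) + 4 * (lam * S ^ 2) with hc₃
  have hr : 0 ≤ L ^ 2 / lam := by positivity
  have hlogr : 0 ≤ Real.log (1 + L ^ 2 / lam) := Real.log_nonneg (by linarith)
  refine ⟨6 + √(2 * c₁ * c₂ * c₃), ?_⟩
  intro d Ω _ μ _ ι _ θ 𝒜 x A Y hx hA hY hsub hrun hbound hθ hbdd hgap1 hnonneg T hT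
  -- in dimension zero all rewards vanish, and the tail bound below needs `d ≥ 1`
  rcases Nat.eq_zero_or_pos d with rfl | hd
  · simp [pathRegret_eq_zero]
  have hl := half_le_log hT
  have hd1 : (1 : ℝ) ≤ d := by exact_mod_cast hd
  have hboundall : ∀ᵐ ω ∂μ, ∀ t, 1 ≤ t → ‖x t (A t ω)‖ ≤ L :=
    ae_all_iff.2 fun t => Filter.eventually_imp_distrib_left.2 (hbound t)
  have hXm : ∀ t, Measurable fun ω => x t (A t ω) := fun t => (hx t).comp (hA t)
  have hinner : ∀ t, Measurable fun ω => inner ℝ θ (x t (A t ω)) := fun t =>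
    Measurable.comp (g := fun v => inner ℝ θ v) (by fun_prop) (hXm t)
  -- the integrability of the regret
  have hgapint : ∀ t, 1 ≤ t → Integrable (fun ω => gap θ (𝒜 t) (x t) (A t ω)) μ := by
    intro t ht
    refine Integrable.of_bound (measurable_const.sub (hinner t)).aestronglyMeasurable 1 ?_
    filter_upwards [hrun] with ω hω
    have hmem := (hω t ht).1
    rw [Real.norm_eq_abs, abs_of_nonneg (gap_nonneg (hbdd t ht) hmem)]
    exact hgap1 t ht _ hmem
  have hint : Integrable (fun ω => pathRegret θ 𝒜 x (fun t => A t ω) T) μ :=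
    integrable_finsetSum _ fun t ht => hgapint t (Finset.mem_Icc.1 ht).1
  refine ⟨hint, ?_⟩
  -- the event that the noise vector leaves its confidence bound in round `t`
  let bad : ℕ → Set Ω := fun t =>
    {ω | R * √(d * Real.log ((1 + (t - 1 : ℕ) * L ^ 2 / lam) / (1 / (t : ℝ) ^ 2))) <
      √(sqInvNorm (designMatrix lam (fun s => x s (A s ω)) (t - 1))
        (responseVector (fun s => x s (A s ω))
          (fun s => Y s ω - inner ℝ θ (x s (A s ω))) (t - 1)))}
  have hbadm : ∀ t, MeasurableSet (bad t) := fun t =>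
    measurableSet_lt measurable_const (measurable_sqInvNorm_responseVector lam
      (fun s _ _ => hXm s) (fun s _ _ => (hY s).sub (hinner s))).sqrt
  have hbad : ∀ t, 1 ≤ t → μ.real (bad t) ≤ 1 / t := fun t ht =>
    ENNReal.toReal_le_of_le_ofReal (by positivity)
      (measure_noise_gt_le hlam hR hd hx hA hY hsub hbound ht)
  set B : ℝ := (c₂ * Real.log T) * (c₃ * (d * Real.log T)) with hB
  have hc₁' : 1 ≤ c₁ := by rw [hc₁]; linarith
  have hc₂' : 2 ≤ c₂ := by
    rw [hc₂]
    linarith [Real.exp_nonneg 16]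
  have hc₃' : 1 ≤ c₃ * (d * Real.log T) :=
    (one_le_confWidth hR hlamS (1 - 1) _).trans (confWidth_le hlam hd hT le_rfl (by omega))
  have hc₃'' : 0 ≤ c₃ := by positivity
  have hB1 : 1 ≤ B := one_le_mul_of_one_le_of_one_le (by nlinarith) hc₃'
  have hpath : ∀ᵐ ω ∂μ, pathRegret θ 𝒜 x (fun t => A t ω) T ≤
      ∑ t ∈ Finset.Icc 1 T, (bad t).indicator 1 ω +
        √(T * (B * (2 * (d * Real.log (1 + T * L ^ 2 / lam))))) := by
    filter_upwards [hrun, hboundall] with ω hω hLω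
    refine pathRegret_le (bad := {t | ω ∈ bad t}) hlam hB1 hLω
      (fun t ht => hgap1 t ht _ (hω t ht).1) (fun t ht hgood => ?_)
      (fun t ht => gap_nonneg (hbdd t ht) (hω t ht).1)
    obtain ⟨ht1, htT⟩ := Finset.mem_Icc.1 ht
    refine (sq_gap_le_of_isRun hlam hR hS hlamS hω hLω hθ ht1 (hbdd t ht1) (hnonneg t ht1)
      (not_lt.1 hgood)).trans ?_
    have hw := sqInvNorm_nonneg (designMatrix_posDef hlam (fun s => x s (A s ω)) (t - 1))
      (x t (A t ω))
    rw [← mul_assoc, hB]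
    gcongr
    · exact zero_le_one.trans (one_le_confWidth hR hlamS _ _)
    · have h1 := log_one_add_natCast_mul_mono hr (show t - 1 ≤ T by omega)
      have h2 := log_one_add_mul_le hr hT
      rw [mul_div_assoc, hc₂, add_mul]
      nlinarith [Real.exp_nonneg 16]
    · exact confWidth_le hlam hd hT ht1 htT
  have hindint : ∀ t, Integrable ((bad t).indicator (1 : Ω → ℝ)) μ := fun t =>
    (integrable_const (1 : ℝ)).indicator (hbadm t)
  calc ∫ ω, pathRegret θ 𝒜 x (fun t => A t ω) T ∂μ
      ≤ ∫ ω, (∑ t ∈ Finset.Icc 1 T, (bad t).indicator 1 ω +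
        √(T * (B * (2 * (d * Real.log (1 + T * L ^ 2 / lam)))))) ∂μ :=
        integral_mono_ae hint
          ((integrable_finsetSum _ fun t _ => hindint t).add (integrable_const _)) hpath
    _ = ∑ t ∈ Finset.Icc 1 T, μ.real (bad t) +
        √(T * (B * (2 * (d * Real.log (1 + T * L ^ 2 / lam))))) := by
        rw [integral_add (integrable_finsetSum _ fun t _ => hindint t) (integrable_const _),
          integral_finsetSum _ fun t _ => hindint t]
        simp [integral_indicator_one (hbadm _)]
    _ ≤ (1 + Real.log T) + √(2 * c₁ * c₂ * c₃ * (T * d ^ 2 * Real.log T ^ 3)) := by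
        refine add_le_add ?_ (Real.sqrt_le_sqrt ?_)
        · exact (Finset.sum_le_sum fun t ht => hbad t (Finset.mem_Icc.1 ht).1).trans
            (sum_inv_le_one_add_log T)
        · have h2 := log_one_add_mul_le hr hT
          rw [mul_div_assoc]
          calc T * (B * (2 * (d * Real.log (1 + T * (L ^ 2 / lam)))))
              ≤ T * (B * (2 * (d * (c₁ * Real.log T)))) := by gcongr
            _ = _ := by rw [hB]; ring
    _ ≤ _ := by
        rw [sqrt_mul_sq_mul_log_pow (by positivity), add_mul]
        gcongr
        exact one_add_log_le hd hT
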